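/- Let $\mathbb O=\mathbb H\oplus\mathbb H$ be the octonions, with multiplication $(q_1,q_2)(p_1,p_2)=(q_1p_1-\bar p_2q_2,\;p_2q_1+q_2\bar p_1)$, conjugation $\overline{(q_1,q_2)}=(\bar q_1,-q_2)$, real part $\mathrm{Re}$ and norm $|a|^2=\mathrm{Re}(a\bar a)$. Let $\mathcal U=U_1\cup U_2\cup U_3\subset\mathbb O^3$ be the set of triples with at least one entry equal to $1$, where $U_i$ consists of the triples whose $i$-th entry is $1$, and let $\mathbb OP^2=\mathcal U/{\sim}$, where $x\sim y$ iff there is $\lambda\in\mathbb O\setminus\{0\}$ with $x_k=y_k\lambda$ for $k=1,2,3$. It is a $16$-dimensional analytic manifold with the charts $\phi_i:U_i/{\sim}\to\mathbb O^2$ $(i=1,2,3)$ given by $[1,u,v]\mapsto(u,v)$, $[u,1,v]\mapsto(u,v)$, $[u,v,1]\mapsto(u,v)$, respectively. (a) There is exactly one smooth Riemannian metric $g$ on $\mathbb OP^2$ which in the coordinates $(u,v)$ of each of the three charts has the form $$ds^2=\frac{|du|^2(1+|v|^2)+|dv|^2(1+|u|^2)-2\,\mathrm{Re}[(u\bar v)(dv\,d\bar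 u)]}{(1+|u|^2+|v|^2)^2}.$$ (b) Let $r\in\mathbb R$ and $\lambda\in\mathbb O$ with $r^2+|\lambda|^2=1$, and let $i\in\{1,2,3\}$. The map $\mathcal R_{r,\lambda}$ of $U_i/{\sim}$ given in the coordinates of $\phi_i$ by $(u,v)\mapsto(ru+\lambda v,\;\bar\lambda u-rv)$ has a unique analytic extension $\widetilde{\mathcal R_{r,\lambda}}:\mathbb OP^2\to\mathbb OP^2$ (a ``reflection''), and this extension is an involutive isometry of $(\mathbb OP^2,g)$. Consequently, for every $t\in\mathbb R$, the ``rotation'' $\mathcal I_t=\widetilde{\mathcal R_{1,0}}\circ\widetilde{\mathcal R_{\cos t,\sin t}}$, formed with the reflections of $U_3/{\sim}$, is well defined. (c) Every finite composition of reflections $\widetilde{\mathcal R_{r,\lambda}}$ of $U_1/{\sim}$ (with $r^2+|\lambda|^2=1$) and rotations $\mathcal I_t$ is an isometry of $(\mathbb OP^2,g)$, and for every point $p\in\mathbb OP^2$ some such composition takes $[1,0,0]$ to $p$. (d) $(\mathbb OP^2,g)$ is homogeneous: for all $p,q\in\mathbb OP^2$ there is an isometry of $(\mathbb OP^2,g)$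 taking $p$ to $q$. Here an isometry is a diffeomorphism of $\mathbb OP^2$ onto itself that preserves $g$. -/

import Mathlib

open scoped Quaternion Manifold ContDiff

noncomputable section

/-! ### The octonions -/

/-- The octonions `𝕆 = ℍ ⊕ ℍ`, with the Euclidean norm `|(q₁, q₂)|² = |q₁|² + |q₂|²`. -/
def Octonion : Type := WithLp 2 (ℍ[ℝ] × ℍ[ℝ])

namespace Octonion

instance : NormedAddCommGroup Octonion :=
  inferInstanceAs (NormedAddCommGroup (WithLp 2 (ℍ[ℝ] × ℍ[ℝ])))

instance : InnerProductSpace ℝ Octonion :=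
  inferInstanceAs (InnerProductSpace ℝ (WithLp 2 (ℍ[ℝ] × ℍ[ℝ])))

/-- The octonion `(q₁, q₂)`. -/
def mk (q₁ q₂ : ℍ[ℝ]) : Octonion := WithLp.toLp 2 (q₁, q₂)

/-- First quaternionic component. -/
def fst (a : Octonion) : ℍ[ℝ] := (WithLp.ofLp a).1

/-- Second quaternionic component. -/
def snd (a : Octonion) : ℍ[ℝ] := (WithLp.ofLp a).2

instance : One Octonion := ⟨mk 1 0⟩

/-- Cayley-Dickson multiplication. -/
instance : Mul Octonion :=
  ⟨fun a b => mk (a.fst * b.fst - star b.snd * a.snd) (b.snd * a.fst + a.snd * star b.fst)⟩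

/-- Octonionic conjugation. -/
instance : Star Octonion := ⟨fun a => mk (star a.fst) (-a.snd)⟩

/-- The real part. -/
def re (a : Octonion) : ℝ := a.fst.re

/-- The inverse `a⁻¹ = |a|⁻² ā` (and `0⁻¹ = 0`). -/
instance : Inv Octonion := ⟨fun a => (‖a‖ ^ 2)⁻¹ • star a⟩

@[ext] theorem ext {a b : Octonion} (h₁ : a.fst = b.fst) (h₂ : a.snd = b.snd) : a = b :=
  WithLp.ofLp_injective 2 (Prod.ext h₁ h₂)

@[simp] theorem fst_mk (p q : ℍ[ℝ]) : (mk p q).fst = p := rfl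
@[simp] theorem snd_mk (p q : ℍ[ℝ]) : (mk p q).snd = q := rfl
@[simp] theorem fst_zero : (0 : Octonion).fst = 0 := rfl
@[simp] theorem snd_zero : (0 : Octonion).snd = 0 := rfl
@[simp] theorem fst_one : (1 : Octonion).fst = 1 := rfl
@[simp] theorem snd_one : (1 : Octonion).snd = 0 := rfl
@[simp] theorem fst_add (a b : Octonion) : (a + b).fst = a.fst + b.fst := rfl
@[simp] theorem snd_add (a b : Octonion) : (a + b).snd = a.snd + b.snd := rfl
@[simp] theorem fst_smul (c : ℝ) (a : Octonion) : (c • a).fst = c • a.fst := rfl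
@[simp] theorem snd_smul (c : ℝ) (a : Octonion) : (c • a).snd = c • a.snd := rfl
@[simp] theorem fst_mul (a b : Octonion) :
    (a * b).fst = a.fst * b.fst - star b.snd * a.snd := rfl
@[simp] theorem snd_mul (a b : Octonion) :
    (a * b).snd = b.snd * a.fst + a.snd * star b.fst := rfl
@[simp] theorem fst_star (a : Octonion) : (star a).fst = star a.fst := rfl
@[simp] theorem snd_star (a : Octonion) : (star a).snd = -a.snd := rfl

theorem inv_def (a : Octonion) : a⁻¹ = (‖a‖ ^ 2)⁻¹ • star a := rfl

theorem norm_sq_eq (a : Octonion) :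
    ‖a‖ ^ 2 = Quaternion.normSq a.fst + Quaternion.normSq a.snd := by
  rw [Quaternion.normSq_eq_norm_mul_self, Quaternion.normSq_eq_norm_mul_self, ← sq, ← sq]
  exact WithLp.prod_norm_sq_eq_of_L2 (α := ℍ[ℝ]) (β := ℍ[ℝ]) a

/-- `|a|² = Re (a ā)`. -/
theorem norm_sq_eq_re (a : Octonion) : ‖a‖ ^ 2 = re (a * star a) := by
  rw [norm_sq_eq, Quaternion.normSq_def', Quaternion.normSq_def']
  simp [re]
  ring

theorem one_mul' (a : Octonion) : 1 * a = a := by ext <;> simp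
theorem mul_one' (a : Octonion) : a * 1 = a := by ext <;> simp
theorem mul_zero' (a : Octonion) : a * 0 = 0 := by ext <;> simp
theorem zero_mul' (a : Octonion) : 0 * a = 0 := by ext <;> simp
theorem mul_smul' (c : ℝ) (a b : Octonion) : a * (c • b) = c • (a * b) := by
  ext <;> simp <;> ring
theorem smul_mul' (c : ℝ) (a b : Octonion) : (c • a) * b = c • (a * b) := by
  ext <;> simp <;> ring

theorem mul_mul_star (a b : Octonion) : (b * a) * star a = (‖a‖ ^ 2) • b := by
  rw [norm_sq_eq, Quaternion.normSq_def', Quaternion.normSq_def']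
  ext <;> simp <;> ring

theorem mul_star_mul (a b : Octonion) : (b * star a) * a = (‖a‖ ^ 2) • b := by
  rw [norm_sq_eq, Quaternion.normSq_def', Quaternion.normSq_def']
  ext <;> simp <;> ring

theorem star_mul_mul (a b : Octonion) : star a * (a * b) = (‖a‖ ^ 2) • b := by
  rw [norm_sq_eq, Quaternion.normSq_def', Quaternion.normSq_def']
  ext <;> simp <;> ring

theorem norm_sq_ne {a : Octonion} (ha : a ≠ 0) : ‖a‖ ^ 2 ≠ 0 :=
  pow_ne_zero 2 (norm_ne_zero_iff.mpr ha)

theorem mul_mul_inv {a : Octonion} (ha : a ≠ 0) (b : Octonion) : (b * a) * a⁻¹ = b := by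
  rw [inv_def, mul_smul', mul_mul_star, smul_smul, inv_mul_cancel₀ (norm_sq_ne ha), one_smul]

theorem mul_inv_mul {a : Octonion} (ha : a ≠ 0) (b : Octonion) : (b * a⁻¹) * a = b := by
  rw [inv_def, mul_smul', smul_mul', mul_star_mul, smul_smul,
    inv_mul_cancel₀ (norm_sq_ne ha), one_smul]

theorem inv_mul_mul {a : Octonion} (ha : a ≠ 0) (b : Octonion) : a⁻¹ * (a * b) = b := by
  rw [inv_def, smul_mul', star_mul_mul, smul_smul, inv_mul_cancel₀ (norm_sq_ne ha), one_smul]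

theorem one_ne_zero' : (1 : Octonion) ≠ 0 := by
  intro h
  have := congrArg fst h
  simp at this

theorem mul_inv_self {a : Octonion} (ha : a ≠ 0) : a * a⁻¹ = 1 := by
  simpa [one_mul'] using mul_mul_inv ha 1

theorem inv_ne_zero' {a : Octonion} (ha : a ≠ 0) : a⁻¹ ≠ 0 := by
  rw [inv_def]
  refine smul_ne_zero (inv_ne_zero (norm_sq_ne ha)) fun h => ha ?_
  have h1 := congrArg fst h
  have h2 := congrArg snd h
  ext1
  · simpa using h1
  · simpa using h2

theorem inv_one' : (1 : Octonion)⁻¹ = 1 := by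
  simpa [one_mul'] using mul_inv_self one_ne_zero'

theorem eq_inv_of_mul_eq_one {a b : Octonion} (hb : b ≠ 0) (h : a * b = 1) : a = b⁻¹ := by
  rw [← mul_mul_inv hb a, h, one_mul']

theorem mul_ne_zero' {a b : Octonion} (ha : a ≠ 0) (hb : b ≠ 0) : a * b ≠ 0 := by
  intro h
  apply ha
  rw [← mul_mul_inv hb a, h, zero_mul']

theorem assoc_of_mul_eq_one {z μ lam : Octonion} (hμ : μ ≠ 0) (hl : lam ≠ 0)
    (h : (z * μ) * lam = 1) : z * (μ * lam) = 1 := by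
  have h1 : z * μ = lam⁻¹ := eq_inv_of_mul_eq_one hl h
  have h2 : z = lam⁻¹ * μ⁻¹ := by rw [← h1, mul_mul_inv hμ]
  rw [h2]
  have key : (star lam * star μ) * (μ * lam) = (‖lam‖ ^ 2 * ‖μ‖ ^ 2) • (1 : Octonion) := by
    rw [norm_sq_eq, norm_sq_eq, Quaternion.normSq_def', Quaternion.normSq_def',
      Quaternion.normSq_def', Quaternion.normSq_def']
    ext <;> simp <;> ring
  rw [inv_def, inv_def, smul_mul', mul_smul', smul_mul', smul_mul', key, smul_smul, smul_smul]
  have := norm_sq_ne hμ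
  have := norm_sq_ne hl
  have e : (‖lam‖ ^ 2)⁻¹ * ((‖μ‖ ^ 2)⁻¹ * (‖lam‖ ^ 2 * ‖μ‖ ^ 2)) = 1 := by field_simp
  simp [mul_assoc, e]

theorem contDiff_fst {n : ℕ∞ω} : ContDiff ℝ n fst :=
  _root_.contDiff_fst.comp (WithLp.contDiff_ofLp (𝕜 := ℝ) (p := 2) (E := ℍ[ℝ]) (F := ℍ[ℝ]))

theorem contDiff_snd {n : ℕ∞ω} : ContDiff ℝ n snd :=
  _root_.contDiff_snd.comp (WithLp.contDiff_ofLp (𝕜 := ℝ) (p := 2) (E := ℍ[ℝ]) (F := ℍ[ℝ]))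

theorem contDiff_mk {n : ℕ∞ω} : ContDiff ℝ n (fun p : ℍ[ℝ] × ℍ[ℝ] => mk p.1 p.2) :=
  WithLp.contDiff_toLp (𝕜 := ℝ) (p := 2) (E := ℍ[ℝ]) (F := ℍ[ℝ])

theorem contDiff_quatStar {n : ℕ∞ω} : ContDiff ℝ n (star : ℍ[ℝ] → ℍ[ℝ]) :=
  (LinearMap.toContinuousLinearMap
    ({ toFun := star, map_add' := fun a b => star_add a b,
       map_smul' := fun c a => by ext <;> simp } : ℍ[ℝ] →ₗ[ℝ] ℍ[ℝ])).contDiff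

theorem contDiff_mul {n : ℕ∞ω} : ContDiff ℝ n (fun p : Octonion × Octonion => p.1 * p.2) := by
  have h1 : ContDiff ℝ n fun p : Octonion × Octonion => p.1.fst :=
    contDiff_fst.comp _root_.contDiff_fst
  have h2 : ContDiff ℝ n fun p : Octonion × Octonion => p.1.snd :=
    contDiff_snd.comp _root_.contDiff_fst
  have h3 : ContDiff ℝ n fun p : Octonion × Octonion => p.2.fst :=
    contDiff_fst.comp _root_.contDiff_snd
  have h4 : ContDiff ℝ n fun p : Octonion × Octonion => p.2.snd :=
    contDiff_snd.comp _root_.contDiff_snd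
  exact contDiff_mk.comp (((h1.mul h3).sub ((contDiff_quatStar.comp h4).mul h2)).prodMk
    ((h4.mul h1).add (h2.mul (contDiff_quatStar.comp h3))))

theorem contDiff_star {n : ℕ∞ω} : ContDiff ℝ n (star : Octonion → Octonion) :=
  contDiff_mk.comp ((contDiff_quatStar.comp contDiff_fst).prodMk contDiff_snd.neg)

theorem contDiffOn_inv {n : ℕ∞ω} : ContDiffOn ℝ n (fun a : Octonion => a⁻¹) {a | a ≠ 0} := by
  have h : ContDiffOn ℝ n (fun a : Octonion => (‖a‖ ^ 2)⁻¹) {a | a ≠ 0} :=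
    (contDiff_norm_sq ℝ).contDiffOn.inv fun a ha => norm_sq_ne ha
  exact h.smul contDiff_star.contDiffOn

end Octonion

/-! ### The octonionic projective plane as a set and a topological space -/

namespace OP2

open Octonion

/-- The set `𝒰 = U₁ ∪ U₂ ∪ U₃ ⊆ 𝕆³` of triples with at least one entry equal to `1`. -/
def ReducedTriples : Set (Fin 3 → Octonion) := {x | ∃ i, x i = 1}

/-- `x ∼ y` when `x = y λ` entrywise for some nonzero octonion `λ`. -/
def Rel (x y : ReducedTriples) : Prop :=
  ∃ lam : Octonion, lam ≠ 0 ∧ ∀ k, x.1 k = y.1 k * lam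

theorem rel_equivalence : Equivalence Rel where
  refl x := ⟨1, one_ne_zero', fun k => (mul_one' _).symm⟩
  symm := by
    rintro x y ⟨l, hl, h⟩
    exact ⟨l⁻¹, inv_ne_zero' hl, fun k => by rw [h k, mul_mul_inv hl]⟩
  trans := by
    rintro ⟨x, l, hx⟩ ⟨y, k, hy⟩ ⟨z, i, hz⟩ ⟨a, ha, hxy⟩ ⟨m, hm, hyz⟩
    simp only at hxy hyz
    refine ⟨m * a, mul_ne_zero' hm ha, fun j => ?_⟩
    simp only
    rw [hxy, hyz]
    have hk : z k * m = 1 := by rw [← hyz, hy]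
    have hl : (z l * m) * a = 1 := by rw [← hyz, ← hxy, hx]
    by_cases hik : i = k
    · subst hik
      rw [hz, one_mul'] at hk
      rw [hk, mul_one', one_mul']
    by_cases hkl : k = l
    · subst hkl
      rw [hk, one_mul'] at hl
      rw [hl, mul_one', mul_one']
    by_cases hil : i = l
    · subst hil
      rw [hz, one_mul'] at hl
      have : a = m⁻¹ := by rw [← inv_mul_mul hm a, hl, mul_one']
      rw [hl, mul_one', this, mul_mul_inv hm]
    have hj : j = i ∨ j = k ∨ j = l := by omega
    rcases hj with rfl | rfl | rfl
    · rw [hz, one_mul', one_mul']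
    · rw [hk, one_mul', eq_inv_of_mul_eq_one hm hk, inv_mul_mul hm]
    · rw [hl, assoc_of_mul_eq_one hm ha hl]

instance setoid : Setoid ReducedTriples := ⟨Rel, rel_equivalence⟩

end OP2

/-- The octonionic projective plane `𝕆P² = 𝒰 / ∼`, with the quotient topology. -/
def OP2 : Type := Quotient OP2.setoid

namespace OP2

open Octonion

instance : TopologicalSpace OP2 := inferInstanceAs (TopologicalSpace (Quotient OP2.setoid))

/-- The class of a reduced triple. -/
def proj (x : ReducedTriples) : OP2 := Quotient.mk OP2.setoid x

/-- `ofCoords i (u, v)` is `[1, u, v]`, `[u, 1, v]`, `[u, v, 1]` for `i = 0, 1, 2`. -/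
def ofCoords (i : Fin 3) (z : Octonion × Octonion) : OP2 :=
  proj ⟨i.insertNth (1 : Octonion) ![z.1, z.2], i, by simp⟩

/-- Affine coordinates of a triple: the two entries other than the `i`-th, in order,
multiplied on the right by the inverse of the `i`-th. -/
def tripleCoords (i : Fin 3) (x : Fin 3 → Octonion) : Octonion × Octonion :=
  (x (i.succAbove 0) * (x i)⁻¹, x (i.succAbove 1) * (x i)⁻¹)

theorem proj_ofCoords_tripleCoords (i : Fin 3) (x : ReducedTriples) (h : x.1 i ≠ 0) :
    ofCoords i (tripleCoords i x.1) = proj x := by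
  refine Quotient.sound ⟨(x.1 i)⁻¹, inv_ne_zero' h, fun k => ?_⟩
  rcases Fin.eq_self_or_eq_succAbove i k with rfl | ⟨j, rfl⟩
  · simp [mul_inv_self h]
  · fin_cases j <;> simp [tripleCoords]

theorem ofCoords_injective (i : Fin 3) : Function.Injective (ofCoords i) := by
  rintro ⟨u, v⟩ ⟨u', v'⟩ h
  obtain ⟨l, hl, h⟩ := Quotient.exact h
  have h0 := h i
  have h1 := h (i.succAbove 0)
  have h2 := h (i.succAbove 1)
  simp only [Fin.insertNth_apply_same, Fin.insertNth_apply_succAbove, one_mul'] at h0 h1 h2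
  subst h0
  simp only [mul_one', Matrix.cons_val_zero, Matrix.cons_val_one] at h1 h2
  rw [h1, h2]

theorem tripleCoords_congr (i : Fin 3) (x y : ReducedTriples) (h : x ≈ y) :
    tripleCoords i x.1 = tripleCoords i y.1 := by
  obtain ⟨l, hl, hxy⟩ := id h
  by_cases hy : y.1 i = 0
  · have hx : x.1 i = 0 := by rw [hxy, hy, zero_mul']
    simp [tripleCoords, hx, hy, inv_def, mul_zero']
  · have hx : x.1 i ≠ 0 := by rw [hxy]; exact mul_ne_zero' hy hl
    apply ofCoords_injective i
    rw [proj_ofCoords_tripleCoords i x hx, proj_ofCoords_tripleCoords i y hy]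
    exact Quotient.sound h

/-- The affine coordinates on `𝕆P²`: `[1, u, v] ↦ (u, v)`, `[u, 1, v] ↦ (u, v)`,
`[u, v, 1] ↦ (u, v)` for `i = 0, 1, 2` (with an irrelevant value off `Uᵢ / ∼`). -/
def coords (i : Fin 3) (p : OP2) : Octonion × Octonion :=
  Quotient.lift (fun x : ReducedTriples => tripleCoords i x.1) (tripleCoords_congr i) p

theorem coords_ofCoords (i : Fin 3) (z : Octonion × Octonion) :
    coords i (ofCoords i z) = z := by
  change tripleCoords i (i.insertNth (1 : Octonion) ![z.1, z.2]) = z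
  simp [tripleCoords, inv_one', mul_one']

theorem proj_mem_range {i : Fin 3} {x : ReducedTriples} :
    proj x ∈ Set.range (ofCoords i) ↔ x.1 i ≠ 0 := by
  constructor
  · rintro ⟨z, hz⟩
    obtain ⟨l, hl, h⟩ := Quotient.exact hz
    have h0 := h i
    simp only [Fin.insertNth_apply_same] at h0
    intro hx
    rw [hx, zero_mul'] at h0
    exact one_ne_zero' h0
  · intro h
    exact ⟨_, proj_ofCoords_tripleCoords i x h⟩

theorem isQuotientMap_proj : Topology.IsQuotientMap proj := isQuotientMap_quotient_mk'

theorem isOpen_range_ofCoords (i : Fin 3) : IsOpen (Set.range (ofCoords i)) := by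
  rw [← isQuotientMap_proj.isOpen_preimage]
  have : proj ⁻¹' Set.range (ofCoords i) = {x | x.1 i ≠ 0} := by
    ext x; exact proj_mem_range
  rw [this]
  exact isOpen_ne_fun ((continuous_apply i).comp continuous_subtype_val) continuous_const

theorem contDiffOn_tripleCoords (i : Fin 3) :
    ContDiffOn ℝ ω (tripleCoords i) {x | x i ≠ 0} := by
  have hinv : ContDiffOn ℝ ω (fun x : Fin 3 → Octonion => (x i)⁻¹) {x | x i ≠ 0} :=
    contDiffOn_inv.comp (contDiff_apply ℝ Octonion i).contDiffOn fun x hx => hx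
  have hmul (k : Fin 3) :
      ContDiffOn ℝ ω (fun x : Fin 3 → Octonion => x k * (x i)⁻¹) {x | x i ≠ 0} :=
    ContDiff.comp_contDiffOn (g := fun p : Octonion × Octonion => p.1 * p.2)
      (f := fun x : Fin 3 → Octonion => (x k, (x i)⁻¹)) contDiff_mul
      ((contDiff_apply ℝ Octonion k).contDiffOn.prodMk hinv)
  exact (hmul _).prodMk (hmul _)

theorem contDiff_insertNth (i : Fin 3) :
    ContDiff ℝ ω fun z : Octonion × Octonion =>
      (i.insertNth (1 : Octonion) ![z.1, z.2] : Fin 3 → Octonion) := by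
  rw [contDiff_pi]
  intro k
  rcases Fin.eq_self_or_eq_succAbove i k with rfl | ⟨j, rfl⟩
  · simpa using contDiff_const
  · fin_cases j
    · simpa using _root_.contDiff_fst
    · simpa using _root_.contDiff_snd

/-- The chart `φᵢ : Uᵢ / ∼ → 𝕆²`. -/
def chart (i : Fin 3) : OpenPartialHomeomorph OP2 (Octonion × Octonion) where
  toFun := coords i
  invFun := ofCoords i
  source := Set.range (ofCoords i)
  target := Set.univ
  map_source' _ _ := Set.mem_univ _
  map_target' z _ := ⟨z, rfl⟩
  left_inv' := by
    rintro _ ⟨z, rfl⟩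
    rw [coords_ofCoords]
  right_inv' z _ := coords_ofCoords i z
  open_source := isOpen_range_ofCoords i
  open_target := isOpen_univ
  continuousOn_toFun := by
    rw [isQuotientMap_proj.continuousOn_isOpen_iff (isOpen_range_ofCoords i)]
    exact (contDiffOn_tripleCoords i).continuousOn.comp continuous_subtype_val.continuousOn
      fun x hx => proj_mem_range.mp hx
  continuousOn_invFun := by
    refine Continuous.continuousOn ?_
    exact isQuotientMap_proj.continuous.comp
      ((contDiff_insertNth i).continuous.subtype_mk fun z => ⟨i, by simp⟩)

theorem exists_mem_source (p : OP2) : ∃ i, p ∈ (chart i).source := by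
  obtain ⟨⟨x, i, hi⟩, rfl⟩ := Quotient.exists_rep p
  exact ⟨i, proj_mem_range.mpr fun h => one_ne_zero' (hi.symm.trans h)⟩

/-- The atlas `{φ₁, φ₂, φ₃}`. -/
instance : ChartedSpace (Octonion × Octonion) OP2 where
  atlas := Set.range chart
  chartAt p := chart (exists_mem_source p).choose
  mem_chart_source p := (exists_mem_source p).choose_spec
  chart_mem_atlas _ := ⟨_, rfl⟩

instance : IsManifold 𝓘(ℝ, Octonion × Octonion) ω OP2 := by
  apply isManifold_of_contDiffOn
  rintro _ _ ⟨i, rfl⟩ ⟨j, rfl⟩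
  have h := (contDiffOn_tripleCoords j).comp (contDiff_insertNth i).contDiffOn
    (s := {z : Octonion × Octonion | (i.insertNth (1 : Octonion) ![z.1, z.2] : Fin 3 → Octonion) j ≠ 0}) fun z hz => hz
  refine h.mono ?_
  rintro z ⟨hz, -⟩
  exact proj_mem_range.mp hz.2

/-! ### The metric, isometries, reflections and rotations -/

/-- The quadratic form `ds²` at the point with coordinates `z = (u, v)`, evaluated on the
tangent vector `d = (du, dv)`. -/
def ds2 (z d : Octonion × Octonion) : ℝ :=
  (‖d.1‖ ^ 2 * (1 + ‖z.2‖ ^ 2) + ‖d.2‖ ^ 2 * (1 + ‖z.1‖ ^ 2)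
      - 2 * re ((z.1 * star z.2) * (d.2 * star d.1)))
    / (1 + ‖z.1‖ ^ 2 + ‖z.2‖ ^ 2) ^ 2

/-- Smooth Riemannian metrics on `𝕆P²`. -/
abbrev SmoothMetric : Type :=
  Bundle.ContMDiffRiemannianMetric 𝓘(ℝ, Octonion × Octonion) ∞ (Octonion × Octonion)
    (fun p : OP2 => TangentSpace 𝓘(ℝ, Octonion × Octonion) p)

/-- `g` is given by the expression `ds²` in each of the three charts. -/
def IsOctonionicMetric (g : SmoothMetric) : Prop :=
  ∀ (i : Fin 3) (p : OP2), p ∈ (chart i).source →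
    ∀ w : TangentSpace 𝓘(ℝ, Octonion × Octonion) p,
      g.inner p w w = ds2 (chart i p)
        (mfderiv 𝓘(ℝ, Octonion × Octonion) 𝓘(ℝ, Octonion × Octonion) (chart i) p w)

/-- `f` is a (global) isometry of `(𝕆P², g)`: a diffeomorphism preserving `g`. -/
def IsRiemannianIsometry (g : SmoothMetric) (f : OP2 → OP2) : Prop :=
  ∃ Φ : OP2 ≃ₘ^∞⟮𝓘(ℝ, Octonion × Octonion), 𝓘(ℝ, Octonion × Octonion)⟯ OP2, ⇑Φ = f ∧
    ∀ (p : OP2) (w w' : TangentSpace 𝓘(ℝ, Octonion × Octonion) p),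
      g.inner (Φ p)
          (mfderiv 𝓘(ℝ, Octonion × Octonion) 𝓘(ℝ, Octonion × Octonion) Φ p w)
          (mfderiv 𝓘(ℝ, Octonion × Octonion) 𝓘(ℝ, Octonion × Octonion) Φ p w')
        = g.inner p w w'

/-- The isometries of `(𝕆P², g)` act transitively. -/
def IsHomogeneous (g : SmoothMetric) : Prop :=
  ∀ p q : OP2, ∃ f : OP2 → OP2, IsRiemannianIsometry g f ∧ f p = q

/-- `(u, v) ↦ (r u + λ v, λ̄ u - r v)`. -/
def reflectionCoords (r : ℝ) (lam : Octonion) (z : Octonion × Octonion) :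
    Octonion × Octonion :=
  (r • z.1 + lam * z.2, star lam * z.1 - r • z.2)

/-- `f` is an analytic extension to `𝕆P²` of the reflection `R_{r,λ}` of the chart domain
`Uᵢ / ∼`. -/
def IsGlobalReflection (i : Fin 3) (r : ℝ) (lam : Octonion) (f : OP2 → OP2) : Prop :=
  ContMDiff 𝓘(ℝ, Octonion × Octonion) 𝓘(ℝ, Octonion × Octonion) ω f ∧
    ∀ z : Octonion × Octonion, f (ofCoords i z) = ofCoords i (reflectionCoords r lam z)

/-- `f` is the rotation `I_t`, the composition of the global extensions of the reflections
`R_{1,0}` and `R_{cos t, sin t}` of `U₃ / ∼`. -/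
def IsRotation (t : ℝ) (f : OP2 → OP2) : Prop :=
  ∃ f₁ f₂ : OP2 → OP2, IsGlobalReflection 2 1 0 f₁ ∧
    IsGlobalReflection 2 (Real.cos t) (Real.sin t • (1 : Octonion)) f₂ ∧ f = f₁ ∘ f₂

/-- Finite compositions of globally extended reflections `R_{r,λ}` of `U₁ / ∼`
(with `r² + |λ|² = 1`) and rotations `I_t`. -/
inductive IsComposite : (OP2 → OP2) → Prop
  | refl : IsComposite id
  | reflection_comp (r : ℝ) (lam : Octonion) (ρ f : OP2 → OP2) (h : r ^ 2 + ‖lam‖ ^ 2 = 1)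
      (hρ : IsGlobalReflection 0 r lam ρ) (hf : IsComposite f) : IsComposite (ρ ∘ f)
  | rotation_comp (t : ℝ) (ρ f : OP2 → OP2)
      (hρ : IsRotation t ρ) (hf : IsComposite f) : IsComposite (ρ ∘ f)

end OP2

end

/-!
Every point of `𝕆P²` has a homogeneous coordinate equal to `1`, so the product `x x*` of its
coordinates involves only associative subalgebras of `𝕆`, and `[x] ↦ x x* / |x|²` is well defined.
It embeds `𝕆P²` into the Hermitian `3 × 3` octonionic matrices as the set of projections of trace
one, which is closed. The expression `ds²` is half of the pullback of the Hilbert–Schmidt inner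
product, in every chart; this gives `g`, which is unique because a symmetric form is determined by
its diagonal.

In the coordinates of `φᵢ` the reflection is `x ↦ R x` for a Hermitian matrix `R`, which on the
embedded points is the linear isometry `P ↦ R P R`. It preserves the projections of trace one coming
from `Uᵢ / ∼`, hence all of them by density, so the reflection extends to an isometry of `𝕆P²`;
uniqueness and involutivity hold by density too.

The rotations take `[1, 0, 0]` to all points `(x, 0)` of `φ₁` with `x` real. Two reflections of
`U₁ / ∼` take `(x, 0)` to an arbitrary point of norm `|x|`, so `U₁ / ∼` is reached. Since `I_{π/2}`
carries `U₁ / ∼` to `U₂ / ∼` and the reflection of `U₁ / ∼` with `r = 0`, `λ = 1` exchanges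
`U₂ / ∼` and `U₃ / ∼`, every point is reached.
-/

noncomputable section

set_option maxSynthPendingDepth 3

namespace Octonion

/-! ### Composition and Moufang identities -/

scoped instance : NonAssocRing Octonion where
  __ := (inferInstance : AddCommGroup Octonion)
  left_distrib a b c := by ext <;> simp <;> ring
  right_distrib a b c := by ext <;> simp <;> ring
  zero_mul := zero_mul'
  mul_zero := mul_zero'
  one_mul := one_mul'
  mul_one := mul_one'

instance : IsScalarTower ℝ Octonion Octonion := ⟨smul_mul'⟩

instance : SMulCommClass ℝ Octonion Octonion := ⟨fun c a b => (mul_smul' c a b).symm⟩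

instance : StarRing Octonion where
  star_involutive a := by ext1 <;> simp
  star_mul a b := by ext <;> simp
  star_add a b := by ext <;> simp [add_comm]

instance : StarModule ℝ Octonion := ⟨fun c a => by ext <;> simp⟩

instance : NormedStarGroup Octonion where
  norm_star_le a := by
    rw [← sq_le_sq₀ (norm_nonneg _) (norm_nonneg _), norm_sq_eq, norm_sq_eq]
    simp

instance : ContinuousMul Octonion := ⟨(contDiff_mul (n := 0)).continuous⟩

instance : FiniteDimensional ℝ Octonion :=
  inferInstanceAs (FiniteDimensional ℝ (WithLp 2 (ℍ[ℝ] × ℍ[ℝ])))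

theorem inner_eq_re (a b : Octonion) : inner ℝ a b = re (a * star b) := by
  have h : inner ℝ a b = inner ℝ a.fst b.fst + inner ℝ a.snd b.snd :=
    WithLp.prod_inner_apply (𝕜 := ℝ) (E := ℍ[ℝ]) (F := ℍ[ℝ]) a b
  rw [h, Quaternion.inner_def, Quaternion.inner_def]
  simp [re]
  ring

theorem re_eq_inner_one (a : Octonion) : re a = inner ℝ a 1 := by
  rw [inner_eq_re, star_one, mul_one]

theorem re_smul_one (c : ℝ) : re (c • (1 : Octonion)) = c := by simp [re]

theorem star_mul_self (a : Octonion) : star a * a = (‖a‖ ^ 2) • (1 : Octonion) := by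
  simpa only [one_mul] using mul_star_mul a 1

theorem mul_star_self (a : Octonion) : a * star a = (‖a‖ ^ 2) • (1 : Octonion) := by
  simpa only [one_mul] using mul_mul_star a 1

theorem inner_mul_right (a b c : Octonion) :
    inner ℝ (a * c) b = inner ℝ a (b * star c) := by
  rw [inner_eq_re, inner_eq_re]
  simp [re]
  ring

theorem inner_mul_left (a b c : Octonion) :
    inner ℝ (c * a) b = inner ℝ a (star c * b) := by
  rw [inner_eq_re, inner_eq_re]
  simp [re]
  ring

theorem inner_star_star (a b : Octonion) : inner ℝ (star a) (star b) = inner ℝ a b := by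
  rw [inner_eq_re, inner_eq_re]
  simp [re]

theorem inner_mul_mul_same (a b c : Octonion) :
    inner ℝ (a * c) (b * c) = inner ℝ a b * ‖c‖ ^ 2 := by
  rw [inner_mul_right, mul_mul_star, real_inner_smul_right, mul_comm]

instance : NormMulClass Octonion where
  norm_mul a b := by
    rw [← sq_eq_sq₀ (norm_nonneg _) (by positivity), mul_pow, ← real_inner_self_eq_norm_sq,
      inner_mul_mul_same, real_inner_self_eq_norm_sq]

instance : NormOneClass Octonion where
  norm_one := by
    rw [← sq_eq_sq₀ (norm_nonneg _) zero_le_one, norm_sq_eq]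
    simp

theorem inner_mul_mul_add_inner_mul_mul (a b c d : Octonion) :
    inner ℝ (a * c) (b * d) + inner ℝ (a * d) (b * c) = 2 * (inner ℝ a b * inner ℝ c d) := by
  have h := inner_mul_mul_same a b (c + d)
  rw [norm_add_sq_real] at h
  simp only [mul_add, inner_add_left, inner_add_right, inner_mul_mul_same] at h
  linarith

theorem mul_star_add_mul_star (a b : Octonion) :
    a * star b + b * star a = (2 * inner ℝ a b) • (1 : Octonion) := by
  have h := mul_star_self (a + b)
  simp only [star_add, mul_add, add_mul, mul_star_self, norm_add_sq_real, add_smul] at h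
  rw [← sub_eq_zero] at h ⊢
  rw [← h]
  abel

theorem mul_star_mul_self (l b : Octonion) :
    (l * star b) * l = (2 * inner ℝ l b) • l - (‖l‖ ^ 2) • b := by
  rw [eq_sub_of_add_eq (mul_star_add_mul_star l b), sub_mul, smul_mul_assoc, one_mul, mul_star_mul]

/-- Adjointness and the polarised composition law evaluate both sides to
`2 ⟨l, b⟩ l - |l|² b` with `b = star (v * u)`. -/
theorem middle_moufang (l v u : Octonion) : (l * v) * (u * l) = (l * (v * u)) * l := by
  have hlhs : (l * v) * (u * l) =
      (2 * inner ℝ l (star u * star v)) • l - (‖l‖ ^ 2) • (star u * star v) := by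
    refine ext_inner_right ℝ fun x => ?_
    have hpol := inner_mul_mul_add_inner_mul_mul l x v (star l * star u)
    have hcancel : l * (star l * star u) = (‖l‖ ^ 2) • star u := by
      simpa only [star_star, norm_star] using star_mul_mul (star l) (star u)
    have hinner : inner ℝ v (star l * star u) = inner ℝ l (star u * star v) := by
      rw [← inner_mul_left, inner_mul_right]
    have hswap : inner ℝ (star u) (x * v) = inner ℝ (star u * star v) x := by
      rw [real_inner_comm, inner_mul_right, real_inner_comm]
    rw [hcancel, real_inner_smul_left, hinner, hswap] at hpol
    rw [inner_mul_right, star_mul, inner_sub_left, real_inner_smul_left, real_inner_smul_left]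
    linarith
  rw [hlhs, ← star_mul, ← mul_star_mul_self, star_star]

theorem eq_re_smul_one_of_isSelfAdjoint {a : Octonion} (h : IsSelfAdjoint a) :
    a = re a • (1 : Octonion) := by
  have hadd : a + a = (2 * re a) • (1 : Octonion) := by
    simpa only [star_one, mul_one, one_mul, h.star_eq, ← re_eq_inner_one] using
      mul_star_add_mul_star a 1
  rw [← two_smul ℝ, mul_smul] at hadd
  exact smul_right_injective Octonion (two_ne_zero' ℝ) hadd

theorem contDiff_re {n : ℕ∞ω} : ContDiff ℝ n re := by
  rw [funext re_eq_inner_one]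
  exact contDiff_id.inner ℝ contDiff_const

end Octonion

namespace OP2

open Octonion
open scoped Matrix Matrix.Norms.Frobenius

/-! ### Octonionic matrices with the Hilbert–Schmidt norm -/

/-- The topology of the Frobenius norm. It is the product topology, but only this form of it is
recognised as the topology underlying the norm. -/
local instance frobeniusTopology {m n E : Type*} [Fintype m] [Fintype n] [NormedAddCommGroup E] :
    TopologicalSpace (Matrix m n E) :=
  (Matrix.frobeniusNormedAddCommGroup :
    NormedAddCommGroup (Matrix m n E)).toPseudoMetricSpace.toUniformSpace.toTopologicalSpace

theorem frobenius_norm_sq {m n E : Type*} [Fintype m] [Fintype n] [NormedAddCommGroup E]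
    (P : Matrix m n E) : ‖P‖ ^ 2 = ∑ a, ∑ b, ‖P a b‖ ^ 2 := by
  have h : 0 ≤ ∑ a, ∑ b, ‖P a b‖ ^ 2 := by positivity
  rw [Matrix.frobenius_norm_def, ← Real.sqrt_eq_rpow]
  simp only [Real.rpow_two]
  exact Real.sq_sqrt h

/-- The Hilbert–Schmidt inner product, whose norm is the Frobenius norm. -/
local instance frobeniusInnerProductSpace {m n E : Type*} [Fintype m] [Fintype n]
    [NormedAddCommGroup E] [InnerProductSpace ℝ E] : InnerProductSpace ℝ (Matrix m n E) where
  __ := (Matrix.frobeniusNormedSpace : NormedSpace ℝ (Matrix m n E))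
  inner P Q := ∑ a, ∑ b, inner ℝ (P a b) (Q a b)
  norm_sq_eq_re_inner P := by
    simp only [frobenius_norm_sq, real_inner_self_eq_norm_sq]
    rfl
  conj_inner_symm P Q := by simp [real_inner_comm]
  add_left P Q R := by simp [inner_add_left, Finset.sum_add_distrib]
  smul_left P Q c := by simp [real_inner_smul_left, Finset.mul_sum]

theorem frobenius_inner_def {m n E : Type*} [Fintype m] [Fintype n]
    [NormedAddCommGroup E] [InnerProductSpace ℝ E] (P Q : Matrix m n E) :
    inner ℝ P Q = ∑ a, ∑ b, inner ℝ (P a b) (Q a b) := rfl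

theorem norm_sq_deriv_normalize {W : Type*} [NormedAddCommGroup W] [InnerProductSpace ℝ W]
    {X : ℝ → W} {N : ℝ → ℝ} {X' : W} {N' t : ℝ} (hX : HasDerivAt X X' t) (hN : HasDerivAt N N' t)
    (hnorm : ∀ s, ‖X s‖ = N s) (h0 : N t ≠ 0) :
    ‖deriv (fun s => (N s)⁻¹ • X s) t‖ ^ 2 = (‖X'‖ ^ 2 - N' ^ 2) / N t ^ 2 := by
  have hinner : inner ℝ (X t) X' = N t * N' := by
    have h1 := hX.norm_sq
    have h2 := hN.pow 2
    simp only [hnorm] at h1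
    have h := h1.unique h2
    rw [Nat.cast_two, Nat.add_one_sub_one, pow_one] at h
    linarith
  rw [((hN.fun_inv h0).fun_smul hX).deriv, norm_add_sq_real, norm_smul, norm_smul, mul_pow, mul_pow,
    real_inner_smul_left, real_inner_smul_right, real_inner_comm, hinner, hnorm,
    Real.norm_eq_abs, Real.norm_eq_abs, sq_abs, sq_abs]
  field_simp
  ring

theorem hasDerivAt_quadratic_zero {W : Type*} [NormedAddCommGroup W] [NormedSpace ℝ W]
    (A B C : W) : HasDerivAt (fun t : ℝ => A + t • B + t ^ 2 • C) B 0 := by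
  simpa using (((hasDerivAt_id (0 : ℝ)).smul_const B).const_add A).fun_add
    (((hasDerivAt_id (0 : ℝ)).fun_pow 2).smul_const C)

section

variable {ι : Type*}

/-- The Hermitian matrix `x x*`. -/
def outer (x : ι → Octonion) : Matrix ι ι Octonion := Matrix.vecMulVec x (star x)

theorem outer_apply (x : ι → Octonion) (a b : ι) : outer x a b = x a * star (x b) := rfl

theorem conjTranspose_outer (x : ι → Octonion) : (outer x)ᴴ = outer x := by
  ext1 a b
  simp only [Matrix.conjTranspose_apply, outer_apply, star_mul, star_star]

theorem outer_smul (c : ℝ) (x : ι → Octonion) : outer (c • x) = c ^ 2 • outer x := by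
  ext1 a b
  simp only [Matrix.smul_apply, outer_apply, Pi.smul_apply, star_smul, star_trivial,
    smul_mul_smul_comm, sq]

variable [Fintype ι]

/-- The matrix `x x* / |x|²`. When `x` spans an octonionic line this is the projection onto it, and
the line can be recovered from it. -/
def projector (x : ι → Octonion) : Matrix ι ι Octonion := (∑ k, ‖x k‖ ^ 2)⁻¹ • outer x

theorem projector_smul {c : ℝ} (hc : c ≠ 0) (x : ι → Octonion) :
    projector (c • x) = projector x := by
  have hsum : ∑ k, ‖(c • x) k‖ ^ 2 = c ^ 2 * ∑ k, ‖x k‖ ^ 2 := by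
    simp only [Pi.smul_apply, norm_smul, mul_pow, Real.norm_eq_abs, sq_abs, Finset.mul_sum]
  rw [projector, projector, hsum, outer_smul, smul_smul]
  congr 1
  field_simp

theorem norm_outer (x : ι → Octonion) : ‖outer x‖ = ∑ k, ‖x k‖ ^ 2 := by
  rw [← sq_eq_sq₀ (norm_nonneg _) (by positivity), frobenius_norm_sq]
  simp only [outer_apply, norm_mul, norm_star, mul_pow]
  rw [sq, Finset.sum_mul_sum]

theorem projector_eq_of_outer_eq_smul {x y : ι → Octonion} {c : ℝ}
    (hc : 0 < c) (h : outer x = c • outer y) : projector x = projector y := by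
  rw [projector, projector, ← norm_outer, ← norm_outer, h, norm_smul, Real.norm_of_nonneg hc.le,
    mul_inv, smul_smul, mul_right_comm, inv_mul_cancel₀ hc.ne', one_mul]

theorem norm_sq_vecMulVec_add (x y : ι → Octonion) :
    ‖Matrix.vecMulVec x (star y) + Matrix.vecMulVec y (star x)‖ ^ 2 =
      2 * ((∑ k, ‖x k‖ ^ 2) * ∑ k, ‖y k‖ ^ 2) + (2 * ∑ k, inner ℝ (x k) (y k)) ^ 2
        - 2 * inner ℝ (outer x) (outer y) := by
  have hentry (a b : ι) : ‖x a * star (y b) + y a * star (x b)‖ ^ 2 =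
      ‖x a‖ ^ 2 * ‖y b‖ ^ 2 + ‖y a‖ ^ 2 * ‖x b‖ ^ 2
        + 4 * (inner ℝ (x a) (y a) * inner ℝ (x b) (y b))
        - 2 * inner ℝ (x a * star (x b)) (y a * star (y b)) := by
    have h := inner_mul_mul_add_inner_mul_mul (x a) (y a) (star (x b)) (star (y b))
    rw [norm_add_sq_real, norm_mul, norm_mul, norm_star, norm_star]
    rw [inner_star_star] at h
    linarith
  rw [frobenius_norm_sq, frobenius_inner_def, mul_pow, sq (∑ k, inner ℝ (x k) (y k))]
  simp only [Matrix.add_apply, Matrix.vecMulVec_apply, Pi.star_apply, hentry, outer_apply,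
    Finset.sum_sub_distrib, Finset.sum_add_distrib, ← Finset.mul_sum, ← Finset.sum_mul]
  ring

theorem norm_sq_deriv_projector_line (x y : ι → Octonion) (hx : ∑ k, ‖x k‖ ^ 2 ≠ 0) :
    ‖deriv (fun t : ℝ => projector (x + t • y)) 0‖ ^ 2 =
      2 * ((∑ k, ‖x k‖ ^ 2) * (∑ k, ‖y k‖ ^ 2) - inner ℝ (outer x) (outer y))
        / (∑ k, ‖x k‖ ^ 2) ^ 2 := by
  set X' := Matrix.vecMulVec x (star y) + Matrix.vecMulVec y (star x) with hX'
  have hX : HasDerivAt (fun t : ℝ => outer (x + t • y)) X' 0 := by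
    have hexpand (t : ℝ) : outer (x + t • y) = outer x + t • X' + t ^ 2 • outer y := by
      ext1 a b
      simp only [outer_apply, hX', Matrix.add_apply, Matrix.smul_apply, Matrix.vecMulVec_apply,
        Pi.add_apply, Pi.smul_apply, Pi.star_apply, star_add, star_smul, star_trivial, mul_add,
        add_mul, smul_mul_assoc, mul_smul_comm, smul_add, smul_smul, sq]
      abel
    rw [funext hexpand]
    exact hasDerivAt_quadratic_zero (outer x) X' (outer y)
  have hN : HasDerivAt (fun t : ℝ => ∑ k, ‖(x + t • y) k‖ ^ 2)
      (2 * ∑ k, inner ℝ (x k) (y k)) 0 := by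
    rw [Finset.mul_sum]
    refine HasDerivAt.fun_sum fun k _ => ?_
    simpa using (((hasDerivAt_id (0 : ℝ)).smul_const (y k)).const_add (x k)).norm_sq
  have h0 : ∑ k, ‖(x + (0 : ℝ) • y) k‖ ^ 2 ≠ 0 := by
    rwa [zero_smul, add_zero]
  have h := norm_sq_deriv_normalize hX hN (fun t => norm_outer _) h0
  rw [norm_sq_vecMulVec_add, zero_smul, add_zero] at h
  refine h.trans ?_
  ring

end

/-! ### Rank-one projections -/

theorem sum_univ_eq_add_add {M : Type*} [AddCommMonoid M] {a b c : Fin 3} (hab : a ≠ b)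
    (hac : a ≠ c) (hbc : b ≠ c) (f : Fin 3 → M) : ∑ k, f k = f a + f b + f c := by
  have huniv : (Finset.univ : Finset (Fin 3)) = {a, b, c} := by
    decide +revert
  rw [huniv, Finset.sum_insert (by simp [hab, hac]), Finset.sum_pair hbc, add_assoc]

/-- Since one entry is `1`, each product involves at most two further octonions, and these generate
an associative algebra; the identity fails for general triples. -/
theorem outer_apply_mul_outer_apply {x : Fin 3 → Octonion} {m : Fin 3} (hm : x m = 1)
    (a b c : Fin 3) : outer x a c * outer x c b = (‖x c‖ ^ 2) • outer x a b := by
  simp only [outer_apply]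
  obtain rfl | rfl | rfl | rfl | rfl | rfl :
      a = m ∨ b = m ∨ c = m ∨ a = c ∨ c = b ∨ a = b := by omega
  · rw [hm, one_mul, one_mul, star_mul_mul]
  · rw [hm, star_one, mul_one, mul_one, mul_star_mul]
  · rw [hm, star_one, mul_one, one_mul, norm_one, one_pow, one_smul]
  · rw [mul_star_self, smul_mul_assoc, one_mul]
  · rw [mul_star_self, mul_smul_comm, mul_one]
  · rw [← star_star (x a * star (x c)), star_mul, star_star, star_mul_self, mul_star_self,
      norm_mul, norm_star, mul_pow, mul_smul]

/-- The projections of trace one in the Jordan algebra of Hermitian `3 × 3` octonionic matrices,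
the standard model of `𝕆P²`. -/
def rankOneProjections : Set (Matrix (Fin 3) (Fin 3) Octonion) :=
  {P | IsStarProjection P ∧ P.trace = 1}

theorem isClosed_rankOneProjections : IsClosed rankOneProjections := by
  have hset : rankOneProjections = {P | P * P = P} ∩ {P | Pᴴ = P} ∩ {P | P.trace = 1} := by
    ext P
    simp only [rankOneProjections, isStarProjection_iff, IsIdempotentElem, IsSelfAdjoint,
      Matrix.star_eq_conjTranspose, Set.mem_inter_iff, Set.mem_ofPred_eq]
  rw [hset]
  exact ((isClosed_eq (by fun_prop) continuous_id).inter
    (isClosed_eq (by fun_prop) continuous_id)).inter (isClosed_eq (by fun_prop) continuous_const)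

theorem sum_norm_sq_pos {ι : Type*} [Fintype ι] {x : ι → Octonion} {m : ι} (hm : x m = 1) :
    0 < ∑ k, ‖x k‖ ^ 2 :=
  Finset.sum_pos' (fun _ _ => by positivity) ⟨m, Finset.mem_univ m, by simp [hm]⟩

theorem projector_mem_rankOneProjections {x : Fin 3 → Octonion} {m : Fin 3} (hm : x m = 1) :
    projector x ∈ rankOneProjections := by
  have hN := (sum_norm_sq_pos hm).ne'
  refine ⟨⟨?_, ?_⟩, ?_⟩
  · ext1 a b
    simp only [Matrix.mul_apply, projector, Matrix.smul_apply, smul_mul_smul_comm,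
      outer_apply_mul_outer_apply hm, smul_smul, ← Finset.sum_smul, ← Finset.mul_sum]
    congr 1
    field_simp
  · rw [IsSelfAdjoint, Matrix.star_eq_conjTranspose, projector, Matrix.conjTranspose_smul,
      conjTranspose_outer, star_trivial]
  · simp only [Matrix.trace, Matrix.diag, projector, Matrix.smul_apply, outer_apply, mul_star_self,
      smul_smul, ← Finset.sum_smul, ← Finset.mul_sum]
    rw [inv_mul_cancel₀ hN, one_smul]

section

variable {P : Matrix (Fin 3) (Fin 3) Octonion}

theorem star_apply_of_mem_rankOneProjections (hP : P ∈ rankOneProjections) (a b : Fin 3) :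
    star (P a b) = P b a :=
  congrFun₂ hP.1.isSelfAdjoint b a

theorem apply_self_of_mem_rankOneProjections (hP : P ∈ rankOneProjections) (a : Fin 3) :
    P a a = re (P a a) • (1 : Octonion) :=
  eq_re_smul_one_of_isSelfAdjoint (star_apply_of_mem_rankOneProjections hP a a)

theorem sum_re_apply_self (hP : P ∈ rankOneProjections) : ∑ a, re (P a a) = 1 := by
  have h := hP.2
  simp only [Matrix.trace, Matrix.diag_apply, re_eq_inner_one, ← sum_inner] at h ⊢
  rw [h, real_inner_self_eq_norm_sq, norm_one, one_pow]

theorem sum_norm_sq_apply (hP : P ∈ rankOneProjections) (a : Fin 3) :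
    ∑ b, ‖P a b‖ ^ 2 = re (P a a) := by
  have h : ∑ b, P a b * star (P a b) = P a a := by
    simp only [star_apply_of_mem_rankOneProjections hP a]
    exact congrFun₂ hP.1.isIdempotentElem a a
  simp only [mul_star_self, ← Finset.sum_smul] at h
  rw [← h, re_smul_one]

theorem norm_sq_apply_of_mem_rankOneProjections (hP : P ∈ rankOneProjections) (a b : Fin 3) :
    ‖P a b‖ ^ 2 = re (P a a) * re (P b b) := by
  have hdiag (c : Fin 3) : ‖P c c‖ ^ 2 = re (P c c) ^ 2 := by
    conv_lhs => rw [apply_self_of_mem_rankOneProjections hP c]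
    rw [norm_smul, norm_one, mul_one, Real.norm_eq_abs, sq_abs]
  have hsymm (c d : Fin 3) : ‖P c d‖ ^ 2 = ‖P d c‖ ^ 2 := by
    rw [← star_apply_of_mem_rankOneProjections hP, norm_star]
  rcases eq_or_ne a b with rfl | hab
  · rw [hdiag, sq]
  obtain ⟨c, hac, hbc⟩ : ∃ c, a ≠ c ∧ b ≠ c := by decide +revert
  have htrace := sum_re_apply_self hP
  have hrow := sum_norm_sq_apply hP
  simp only [sum_univ_eq_add_add hab hac hbc] at htrace hrow
  have ha := hrow a
  have hb := hrow b
  have hc := hrow c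
  rw [hdiag] at ha hb hc
  rw [hsymm b a] at hb
  rw [hsymm c a, hsymm c b] at hc
  -- The row sums determine `‖P a b‖`, `‖P a c‖` and `‖P b c‖` from the diagonal entries.
  grind

theorem apply_mul_apply_of_mem_rankOneProjections (hP : P ∈ rankOneProjections) (a b c : Fin 3) :
    P a c * P c b = re (P c c) • P a b := by
  by_cases hac : a = c
  · subst hac
    conv_lhs => rw [apply_self_of_mem_rankOneProjections hP a]
    rw [smul_mul_assoc, one_mul]
  by_cases hbc : b = c
  · subst hbc
    conv_lhs => rw [apply_self_of_mem_rankOneProjections hP b]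
    rw [mul_smul_comm, mul_one]
  by_cases hab : a = b
  · subst hab
    rw [← star_apply_of_mem_rankOneProjections hP a c, mul_star_self,
      norm_sq_apply_of_mem_rankOneProjections hP, mul_comm, mul_smul,
      ← apply_self_of_mem_rankOneProjections hP]
  -- For distinct indices this is the `(a, b)` entry of `P * P = P`, as `P` has trace one.
  have hentry : ∑ k, P a k * P k b = P a b := congrFun₂ hP.1.isIdempotentElem a b
  have htrace := sum_re_apply_self hP
  rw [sum_univ_eq_add_add hab hac hbc] at hentry htrace
  rw [apply_self_of_mem_rankOneProjections hP a, apply_self_of_mem_rankOneProjections hP b,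
    smul_mul_assoc, one_mul, mul_smul_comm, mul_one] at hentry
  rw [eq_sub_of_add_eq' htrace, eq_sub_of_add_eq' hentry]
  module

theorem exists_projector_eq (hP : P ∈ rankOneProjections) :
    ∃ (x : Fin 3 → Octonion) (m : Fin 3), x m = 1 ∧ projector x = P := by
  obtain ⟨m, -, hm⟩ : ∃ m ∈ Finset.univ, re (P m m) ≠ 0 :=
    Finset.exists_ne_zero_of_sum_ne_zero (by rw [sum_re_apply_self hP]; exact one_ne_zero)
  refine ⟨(re (P m m))⁻¹ • fun k => P k m, m, ?_, ?_⟩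
  · rw [Pi.smul_apply, apply_self_of_mem_rankOneProjections hP m, re_smul_one,
      inv_smul_smul₀ hm]
  have hsum : ∑ k, ‖P k m‖ ^ 2 = re (P m m) := by
    simp only [norm_sq_apply_of_mem_rankOneProjections hP, ← Finset.sum_mul, sum_re_apply_self hP,
      one_mul]
  rw [projector_smul (inv_ne_zero hm), projector, hsum]
  ext1 a b
  rw [Matrix.smul_apply, outer_apply, star_apply_of_mem_rankOneProjections hP,
    apply_mul_apply_of_mem_rankOneProjections hP, inv_smul_smul₀ hm]

end

/-! ### The embedding by rank-one projections -/

/-- The triple with `i`-th entry `c` and remaining entries `z.1`, `z.2`: homogeneous coordinates of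
a point of the chart domain `Uᵢ / ∼` for `c = 1`, a tangent direction for `c = 0`. -/
def triple (i : Fin 3) (c : Octonion) (z : Octonion × Octonion) : Fin 3 → Octonion :=
  i.insertNth c ![z.1, z.2]

@[simp]
theorem triple_apply_same (i : Fin 3) (c : Octonion) (z : Octonion × Octonion) :
    triple i c z i = c := Fin.insertNth_apply_same ..

@[simp]
theorem triple_apply_succAbove_zero (i : Fin 3) (c : Octonion) (z : Octonion × Octonion) :
    triple i c z (i.succAbove 0) = z.1 := Fin.insertNth_apply_succAbove ..

@[simp]
theorem triple_apply_succAbove_one (i : Fin 3) (c : Octonion) (z : Octonion × Octonion) :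
    triple i c z (i.succAbove 1) = z.2 := Fin.insertNth_apply_succAbove ..

theorem triple_add_smul_triple_zero (i : Fin 3) (c : Octonion) (z d : Octonion × Octonion) (t : ℝ) :
    triple i c z + t • triple i 0 d = triple i c (z + t • d) := by
  ext1 k
  obtain rfl | ⟨j, rfl⟩ := Fin.eq_self_or_eq_succAbove i k
  · simp
  · fin_cases j <;> simp

theorem contDiff_triple_apply (i k : Fin 3) : ContDiff ℝ ω fun z => triple i 1 z k :=
  contDiff_pi.mp (contDiff_insertNth i) k

theorem sum_norm_sq_triple (i : Fin 3) (c : Octonion) (z : Octonion × Octonion) :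
    ∑ k, ‖triple i c z k‖ ^ 2 = ‖c‖ ^ 2 + (‖z.1‖ ^ 2 + ‖z.2‖ ^ 2) := by
  rw [Fin.sum_univ_succAbove _ i, Fin.sum_univ_two]
  simp

theorem inner_outer_triple_zero (i : Fin 3) (c : Octonion) (z d : Octonion × Octonion) :
    inner ℝ (outer (triple i c z)) (outer (triple i 0 d)) =
      ‖z.1‖ ^ 2 * ‖d.1‖ ^ 2 + ‖z.2‖ ^ 2 * ‖d.2‖ ^ 2
        + 2 * re ((z.1 * star z.2) * (d.2 * star d.1)) := by
  have hself (a b : Octonion) :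
      inner ℝ (a * star a) (b * star b) = ‖a‖ ^ 2 * ‖b‖ ^ 2 := by
    rw [mul_star_self, mul_star_self, real_inner_smul_left, real_inner_smul_right,
      real_inner_self_eq_norm_sq, norm_one, one_pow, mul_one]
  have hcross : inner ℝ (z.2 * star z.1) (d.2 * star d.1) =
      inner ℝ (z.1 * star z.2) (d.1 * star d.2) := by
    rw [← inner_star_star]
    simp only [star_mul, star_star]
  have hre : re ((z.1 * star z.2) * (d.2 * star d.1)) =
      inner ℝ (z.1 * star z.2) (d.1 * star d.2) := by
    rw [inner_eq_re, star_mul, star_star]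
  simp only [frobenius_inner_def, Fin.sum_univ_succAbove _ i, Fin.sum_univ_two, outer_apply,
    triple_apply_same, triple_apply_succAbove_zero, triple_apply_succAbove_one, star_zero,
    mul_zero, zero_mul, inner_zero_right, zero_add, hself, hcross, hre]
  ring

theorem norm_sq_deriv_projector_triple (i : Fin 3) (z d : Octonion × Octonion) :
    ‖deriv (fun t : ℝ => projector (triple i 1 (z + t • d))) 0‖ ^ 2 = 2 * ds2 z d := by
  have hne : ∑ k, ‖triple i 1 z k‖ ^ 2 ≠ 0 := (sum_norm_sq_pos (triple_apply_same i 1 z)).ne'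
  simp only [← triple_add_smul_triple_zero]
  rw [norm_sq_deriv_projector_line _ _ hne, inner_outer_triple_zero]
  simp only [sum_norm_sq_triple, norm_one, norm_zero, one_pow, ds2]
  ring

/-- Normalising an entry of `x` to `1` forces `l` to be a real multiple of `star (y n)`, so that the
products `y a * l` are entries of `outer y`. -/
theorem projector_eq_of_eq_mul {x y : Fin 3 → Octonion} {m n : Fin 3} (hx : x n = 1) (hy : y m = 1)
    {l : Octonion} (hl : l ≠ 0) (hxy : ∀ k, x k = y k * l) : projector x = projector y := by
  have hyn : y n = l⁻¹ := eq_inv_of_mul_eq_one hl ((hxy n).symm.trans hx)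
  have hl_norm : ‖l‖ ^ 2 ≠ 0 := norm_sq_ne hl
  have hl_eq : l = ‖l‖ ^ 2 • star (y n) := by
    rw [hyn, inv_def, star_smul, star_star, star_trivial, smul_inv_smul₀ hl_norm]
  have hyn_norm : ‖y n‖ ^ 2 = (‖l‖ ^ 2)⁻¹ := by
    rw [hyn, inv_def, norm_smul, norm_star, norm_inv, norm_pow, norm_norm]
    field_simp
  have hx_eq (a : Fin 3) : x a = ‖l‖ ^ 2 • outer y a n := by
    rw [outer_apply, ← mul_smul_comm, ← hl_eq]
    exact hxy a
  refine projector_eq_of_outer_eq_smul (c := ‖l‖ ^ 2) (by positivity) ?_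
  ext1 a b
  rw [outer_apply, hx_eq, hx_eq, star_smul, star_trivial, smul_mul_smul_comm,
    show star (outer y b n) = outer y n b from congrFun₂ (conjTranspose_outer y) n b,
    outer_apply_mul_outer_apply hy, hyn_norm, smul_smul, Matrix.smul_apply,
    mul_assoc, mul_inv_cancel₀ hl_norm, mul_one]

/-- The embedding of `𝕆P²` into octonionic matrices sending the class of `x` to the projection
`x x* / |x|²`. -/
def emb : OP2 → Matrix (Fin 3) (Fin 3) Octonion :=
  Quotient.lift (fun x : ReducedTriples => projector x.1) fun x y h => by
    obtain ⟨l, hl, hxy⟩ := h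
    exact projector_eq_of_eq_mul x.2.choose_spec y.2.choose_spec hl hxy

theorem emb_proj (x : ReducedTriples) : emb (proj x) = projector x.1 := rfl

theorem emb_ofCoords (i : Fin 3) (z : Octonion × Octonion) :
    emb (ofCoords i z) = projector (triple i 1 z) := rfl

theorem range_emb : Set.range emb = rankOneProjections := by
  refine Set.Subset.antisymm ?_ fun P hP => ?_
  · rintro _ ⟨p, rfl⟩
    obtain ⟨⟨x, m, hm⟩, rfl⟩ := isQuotientMap_proj.surjective p
    exact projector_mem_rankOneProjections hm
  · obtain ⟨x, m, hm, rfl⟩ := exists_projector_eq hP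
    exact ⟨proj ⟨x, m, hm⟩, rfl⟩

theorem re_emb_proj_apply_self (x : ReducedTriples) (i : Fin 3) :
    re (emb (proj x) i i) = (∑ k, ‖x.1 k‖ ^ 2)⁻¹ * ‖x.1 i‖ ^ 2 := by
  rw [emb_proj, projector, Matrix.smul_apply, outer_apply, mul_star_self, smul_smul, re_smul_one]

theorem mem_source_iff (i : Fin 3) (p : OP2) : p ∈ (chart i).source ↔ re (emb p i i) ≠ 0 := by
  obtain ⟨x, rfl⟩ := isQuotientMap_proj.surjective p
  have hN : ∑ k, ‖x.1 k‖ ^ 2 ≠ 0 := (sum_norm_sq_pos x.2.choose_spec).ne'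
  rw [re_emb_proj_apply_self]
  exact proj_mem_range.trans (by simp [hN])

/-- The affine coordinates of the point embedded as `P`, read off from the `i`-th column. -/
def matrixCoords (i : Fin 3) (P : Matrix (Fin 3) (Fin 3) Octonion) : Octonion × Octonion :=
  ((re (P i i))⁻¹ • P (i.succAbove 0) i, (re (P i i))⁻¹ • P (i.succAbove 1) i)

theorem matrixCoords_emb (i : Fin 3) (p : OP2) : matrixCoords i (emb p) = coords i p := by
  obtain ⟨x, rfl⟩ := isQuotientMap_proj.surjective p
  have hN : ∑ k, ‖x.1 k‖ ^ 2 ≠ 0 := (sum_norm_sq_pos x.2.choose_spec).ne'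
  have hentry (k : Fin 3) :
      (re (emb (proj x) i i))⁻¹ • emb (proj x) k i = x.1 k * (x.1 i)⁻¹ := by
    rw [re_emb_proj_apply_self, emb_proj, projector, Matrix.smul_apply, outer_apply, smul_smul,
      inv_def, mul_smul_comm, mul_inv, inv_inv, mul_right_comm, mul_inv_cancel₀ hN, one_mul]
  exact Prod.ext (hentry _) (hentry _)

theorem ofCoords_coords {i : Fin 3} {p : OP2} (h : p ∈ (chart i).source) :
    ofCoords i (coords i p) = p :=
  (chart i).left_inv h

theorem emb_injective : Function.Injective emb := by
  intro p q h
  obtain ⟨i, hi⟩ := exists_mem_source p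
  have hi' : q ∈ (chart i).source := by
    rwa [mem_source_iff, ← h, ← mem_source_iff]
  rw [← ofCoords_coords hi, ← ofCoords_coords hi', ← matrixCoords_emb, ← matrixCoords_emb, h]

/-! ### Smoothness of the embedding -/

theorem contDiff_matrix {X m n E : Type*} [NormedAddCommGroup X] [NormedSpace ℝ X] [Fintype m]
    [Fintype n] [NormedAddCommGroup E] [NormedSpace ℝ E] {f : X → Matrix m n E} {k : ℕ∞ω} :
    ContDiff ℝ k f ↔ ∀ a b, ContDiff ℝ k fun x => f x a b := by
  let e : Matrix m n E ≃L[ℝ] (m → n → E) :=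
    { (Matrix.ofLinearEquiv ℝ).symm with
      continuous_toFun := continuous_id
      continuous_invFun := continuous_id }
  rw [← e.comp_contDiff_iff, contDiff_pi]
  simp only [contDiff_pi]
  rfl

theorem contDiff_matrix_apply {m n E : Type*} [Fintype m] [Fintype n] [NormedAddCommGroup E]
    [NormedSpace ℝ E] (a : m) (b : n) {k : ℕ∞ω} :
    ContDiff ℝ k fun P : Matrix m n E => P a b :=
  contDiff_matrix.mp contDiff_id a b

local notation "𝓘𝕆²" => 𝓘(ℝ, Octonion × Octonion)

theorem contDiff_emb_ofCoords (i : Fin 3) : ContDiff ℝ ω fun z => emb (ofCoords i z) := by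
  have hentry (a b : Fin 3) : ContDiff ℝ ω fun z => outer (triple i 1 z) a b :=
    ContDiff.comp (g := fun p : Octonion × Octonion => p.1 * p.2)
      (f := fun z => (triple i 1 z a, star (triple i 1 z b))) contDiff_mul
      ((contDiff_triple_apply i a).prodMk
        (contDiff_star.comp (contDiff_triple_apply i b)))
  have hnorm : ContDiff ℝ ω fun z => ∑ k, ‖triple i 1 z k‖ ^ 2 :=
    ContDiff.sum fun k _ => (contDiff_triple_apply i k).norm_sq ℝ
  exact (hnorm.inv fun z => (sum_norm_sq_pos (triple_apply_same i 1 z)).ne').smul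
    (contDiff_matrix.mpr hentry)

theorem contDiffAt_matrixCoords {i : Fin 3} {P : Matrix (Fin 3) (Fin 3) Octonion}
    (h : re (P i i) ≠ 0) : ContDiffAt ℝ ω (matrixCoords i) P := by
  have hinv : ContDiffAt ℝ ω
      (fun Q : Matrix (Fin 3) (Fin 3) Octonion => (re (Q i i))⁻¹) P :=
    (contDiff_re.comp (contDiff_matrix_apply i i)).contDiffAt.inv h
  exact (hinv.smul (contDiff_matrix_apply _ _).contDiffAt).prodMk
    (hinv.smul (contDiff_matrix_apply _ _).contDiffAt)

theorem chart_mem_maximalAtlas (i : Fin 3) : chart i ∈ IsManifold.maximalAtlas 𝓘𝕆² ω OP2 :=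
  IsManifold.subset_maximalAtlas ⟨i, rfl⟩

theorem contMDiffAt_chart {i : Fin 3} {p : OP2} (h : p ∈ (chart i).source) :
    ContMDiffAt 𝓘𝕆² 𝓘𝕆² ω (chart i) p :=
  (contMDiffOn_of_mem_maximalAtlas (chart_mem_maximalAtlas i)).contMDiffAt
    ((chart i).open_source.mem_nhds h)

theorem contMDiff_ofCoords (i : Fin 3) : ContMDiff 𝓘𝕆² 𝓘𝕆² ω (ofCoords i) := by
  rw [← contMDiffOn_univ]
  exact contMDiffOn_symm_of_mem_maximalAtlas (chart_mem_maximalAtlas i)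

theorem emb_eventuallyEq {i : Fin 3} {p : OP2} (h : p ∈ (chart i).source) :
    emb =ᶠ[nhds p] (fun z => emb (ofCoords i z)) ∘ chart i := by
  filter_upwards [(chart i).open_source.mem_nhds h] with q hq
  exact congrArg emb (ofCoords_coords hq).symm

theorem contMDiff_emb :
    ContMDiff 𝓘𝕆² 𝓘(ℝ, Matrix (Fin 3) (Fin 3) Octonion) ω emb := by
  intro p
  obtain ⟨i, hi⟩ := exists_mem_source p
  exact ((contDiff_emb_ofCoords i).contMDiff.contMDiffAt.comp p
    (contMDiffAt_chart hi)).congr_of_eventuallyEq (emb_eventuallyEq hi)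

instance : T2Space OP2 := T2Space.of_injective_continuous emb_injective contMDiff_emb.continuous

theorem dense_range_ofCoords (i : Fin 3) : DenseRange (ofCoords i) := by
  intro p
  obtain ⟨⟨x, m, hm⟩, rfl⟩ := isQuotientMap_proj.surjective p
  rcases eq_or_ne (x i) 0 with hi | hi
  swap
  · exact subset_closure (proj_mem_range.mpr hi)
  have him : m ≠ i := by
    rintro rfl
    exact one_ne_zero' (hm.symm.trans hi)
  let γ : ℝ → OP2 := fun t => proj ⟨Function.update x i (t • 1), m, by
    rw [Function.update_of_ne him, hm]⟩
  have hγ : Continuous γ := isQuotientMap_proj.continuous.comp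
    ((continuous_const.update i (continuous_id.smul continuous_const)).subtype_mk _)
  have hγ_zero : γ 0 = proj ⟨x, m, hm⟩ :=
    congrArg proj (Subtype.ext (by simp only [zero_smul, ← hi, Function.update_eq_self]))
  have hγ_mem : ∀ t ∈ ({0}ᶜ : Set ℝ), γ t ∈ Set.range (ofCoords i) := fun t ht =>
    proj_mem_range.mpr (by simpa using ⟨ht, one_ne_zero'⟩)
  rw [← hγ_zero]
  exact map_mem_closure hγ (dense_compl_singleton 0 0) hγ_mem

theorem contMDiff_of_contMDiff_emb_comp {E H M : Type*} [NormedAddCommGroup E] [NormedSpace ℝ E]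
    [TopologicalSpace H] {I : ModelWithCorners ℝ E H} [TopologicalSpace M] [ChartedSpace H M]
    {f : M → OP2} {k : ℕ∞ω}
    (h : ContMDiff I 𝓘(ℝ, Matrix (Fin 3) (Fin 3) Octonion) k fun q => emb (f q)) :
    ContMDiff I 𝓘𝕆² k f := by
  intro p
  obtain ⟨i, hi⟩ := exists_mem_source (f p)
  rw [mem_source_iff] at hi
  have hlocal : ContMDiffAt I 𝓘𝕆² k (fun q => ofCoords i (matrixCoords i (emb (f q)))) p :=
    ((contMDiff_ofCoords i).of_le le_top).contMDiffAt.comp p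
      (((contDiffAt_matrixCoords hi).of_le le_top).contMDiffAt.comp p h.contMDiffAt)
  refine hlocal.congr_of_eventuallyEq ?_
  have hre : Continuous fun q => re (emb (f q) i i) :=
    ((contDiff_re (n := 0)).comp (contDiff_matrix_apply i i)).continuous.comp h.continuous
  filter_upwards [hre.isOpen_preimage _ isOpen_ne |>.mem_nhds hi] with q hq
  rw [matrixCoords_emb, ofCoords_coords ((mem_source_iff i _).mpr hq)]

/-! ### Reflections -/

/-- The Hermitian matrix with rows `(r, λ)` and `(λ̄, -r)` in the indices other than `i` and `1` at
`(i, i)`; it represents the reflection `R_{r,λ}` of `Uᵢ / ∼`. -/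
def reflectionMatrix (i : Fin 3) (r : ℝ) (lam : Octonion) : Matrix (Fin 3) (Fin 3) Octonion :=
  Matrix.of (i.insertNth (triple i 1 0)
    ![triple i 0 (r • 1, lam), triple i 0 (star lam, -r • 1)])

section

variable (i : Fin 3) (r : ℝ) (lam : Octonion)

theorem reflectionMatrix_apply_same : reflectionMatrix i r lam i = triple i 1 0 :=
  Fin.insertNth_apply_same (α := fun _ => Fin 3 → Octonion) ..

theorem reflectionMatrix_apply_succAbove_zero :
    reflectionMatrix i r lam (i.succAbove 0) = triple i 0 (r • 1, lam) :=
  Fin.insertNth_apply_succAbove (α := fun _ => Fin 3 → Octonion) ..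

theorem reflectionMatrix_apply_succAbove_one :
    reflectionMatrix i r lam (i.succAbove 1) = triple i 0 (star lam, -r • 1) :=
  Fin.insertNth_apply_succAbove (α := fun _ => Fin 3 → Octonion) ..

theorem conjTranspose_reflectionMatrix :
    (reflectionMatrix i r lam)ᴴ = reflectionMatrix i r lam := by
  refine Matrix.ext ?_
  simp only [Fin.forall_iff_succAbove i, Fin.forall_fin_two, Matrix.conjTranspose_apply,
    reflectionMatrix_apply_same, reflectionMatrix_apply_succAbove_zero,
    reflectionMatrix_apply_succAbove_one, triple_apply_same, triple_apply_succAbove_zero,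
    triple_apply_succAbove_one, star_one, star_zero, star_smul, star_trivial, star_star,
    Prod.fst_zero, Prod.snd_zero, and_self]

theorem reflectionMatrix_mulVec_triple (c : Octonion) (z : Octonion × Octonion) :
    reflectionMatrix i r lam *ᵥ triple i c z = triple i c (reflectionCoords r lam z) := by
  refine funext ?_
  simp only [Fin.forall_iff_succAbove i, Fin.forall_fin_two, Matrix.mulVec, dotProduct,
    Fin.sum_univ_succAbove _ i, Fin.sum_univ_two,
    reflectionMatrix_apply_same, reflectionMatrix_apply_succAbove_zero,
    reflectionMatrix_apply_succAbove_one, triple_apply_same, triple_apply_succAbove_zero,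
    triple_apply_succAbove_one, Prod.fst_zero, Prod.snd_zero, zero_mul, one_mul, zero_add,
    add_zero, smul_mul_assoc, neg_smul, neg_mul, reflectionCoords, sub_eq_add_neg, and_self]

variable {r lam}

theorem sum_norm_sq_reflectionCoords (h : r ^ 2 + ‖lam‖ ^ 2 = 1) (z : Octonion × Octonion) :
    ‖(reflectionCoords r lam z).1‖ ^ 2 + ‖(reflectionCoords r lam z).2‖ ^ 2 =
      ‖z.1‖ ^ 2 + ‖z.2‖ ^ 2 := by
  have hcross : inner ℝ (r • z.1) (lam * z.2) = inner ℝ (star lam * z.1) (r • z.2) := by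
    rw [real_inner_smul_left, real_inner_smul_right, inner_mul_left, star_star]
  simp only [reflectionCoords]
  rw [norm_add_sq_real, norm_sub_sq_real, hcross, norm_smul, norm_smul, norm_mul, norm_mul,
    norm_star, Real.norm_eq_abs]
  simp only [mul_pow, sq_abs]
  linear_combination (‖z.1‖ ^ 2 + ‖z.2‖ ^ 2) * h

theorem reflectionCoords_involutive (h : r ^ 2 + ‖lam‖ ^ 2 = 1) :
    Function.Involutive (reflectionCoords r lam) := by
  rintro ⟨u, v⟩
  have hu : lam * (star lam * u) = ‖lam‖ ^ 2 • u := by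
    simpa only [star_star, norm_star] using star_mul_mul (star lam) u
  have hscale (w : Octonion) : r ^ 2 • w + ‖lam‖ ^ 2 • w = w := by
    rw [← add_smul, h, one_smul]
  simp only [reflectionCoords, mul_sub, mul_add, mul_smul_comm, hu, star_mul_mul, Prod.mk.injEq]
  constructor
  · nth_rw 3 [← hscale u]
    module
  · nth_rw 3 [← hscale v]
    module

theorem norm_reflectionMatrix_mul (h : r ^ 2 + ‖lam‖ ^ 2 = 1)
    (P : Matrix (Fin 3) (Fin 3) Octonion) : ‖reflectionMatrix i r lam * P‖ = ‖P‖ := by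
  have hcol (x : Fin 3 → Octonion) :
      ∑ k, ‖(reflectionMatrix i r lam *ᵥ x) k‖ ^ 2 = ∑ k, ‖x k‖ ^ 2 := by
    obtain ⟨c, z, rfl⟩ : ∃ c z, triple i c z = x :=
      ⟨x i, (x (i.succAbove 0), x (i.succAbove 1)), funext <| by
        simp [Fin.forall_iff_succAbove i, Fin.forall_fin_two]⟩
    rw [reflectionMatrix_mulVec_triple, sum_norm_sq_triple, sum_norm_sq_reflectionCoords h,
      sum_norm_sq_triple]
  rw [← sq_eq_sq₀ (norm_nonneg _) (norm_nonneg _), frobenius_norm_sq, frobenius_norm_sq,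
    Finset.sum_comm, Finset.sum_comm (f := fun a b => ‖P a b‖ ^ 2)]
  exact Finset.sum_congr rfl fun b _ => hcol fun a => P a b

theorem norm_mul_reflectionMatrix (h : r ^ 2 + ‖lam‖ ^ 2 = 1)
    (P : Matrix (Fin 3) (Fin 3) Octonion) : ‖P * reflectionMatrix i r lam‖ = ‖P‖ := by
  rw [← Matrix.frobenius_norm_conjTranspose, Matrix.conjTranspose_mul,
    conjTranspose_reflectionMatrix, norm_reflectionMatrix_mul i h,
    Matrix.frobenius_norm_conjTranspose]

/-- The linear isometry `P ↦ R P R` of octonionic matrices which extends the reflection `R_{r,λ}` of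
`Uᵢ / ∼` along the embedding. -/
def reflectionIsometry (h : r ^ 2 + ‖lam‖ ^ 2 = 1) :
    Matrix (Fin 3) (Fin 3) Octonion →ₗᵢ[ℝ] Matrix (Fin 3) (Fin 3) Octonion where
  toFun P := reflectionMatrix i r lam * P * reflectionMatrix i r lam
  map_add' P Q := by rw [Matrix.mul_add, Matrix.add_mul]
  map_smul' c P := by rw [Matrix.mul_smul, Matrix.smul_mul, RingHom.id_apply]
  norm_map' P := (norm_mul_reflectionMatrix i h _).trans (norm_reflectionMatrix_mul i h P)

theorem mul_mul_add_mul_mul_star (l u v : Octonion) :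
    l * (v * star u) + (u * star v) * star l = (l * v) * star u + u * (star v * star l) := by
  have hl := mul_star_add_mul_star l (u * star v)
  have hr := mul_star_add_mul_star (l * v) u
  rw [star_mul, star_star] at hl
  rw [star_mul, inner_mul_right] at hr
  rw [hl, hr]

theorem reflectionMatrix_mul_outer_mul (c : ℝ) (z : Octonion × Octonion) :
    reflectionMatrix i r lam * outer (triple i (c • 1) z) * reflectionMatrix i r lam =
      outer (triple i (c • 1) (reflectionCoords r lam z)) := by
  obtain ⟨u, v⟩ := z
  have hnorm_zero : (lam * v) * (star v * star lam) = (‖lam‖ ^ 2 * ‖v‖ ^ 2) • 1 := by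
    rw [← star_mul, mul_star_self, norm_mul, mul_pow]
  have hnorm_one : (star lam * u) * (star u * lam) = (‖lam‖ ^ 2 * ‖u‖ ^ 2) • 1 := by
    simpa only [star_mul, star_star, norm_mul, norm_star, mul_pow] using
      mul_star_self (star lam * u)
  have hdiag_zero := mul_mul_add_mul_mul_star lam u v
  have hdiag_one := mul_mul_add_mul_mul_star (star lam) v u
  have hcancel (a b : Octonion) : a * (star a * b) = ‖a‖ ^ 2 • b := by
    simpa only [star_star, norm_star] using star_mul_mul (star a) b
  rw [star_star] at hdiag_one
  refine Matrix.ext ?_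
  simp only [Fin.forall_iff_succAbove i, Fin.forall_fin_two, Matrix.mul_apply,
    Fin.sum_univ_succAbove _ i, Fin.sum_univ_two, outer_apply, reflectionCoords,
    reflectionMatrix_apply_same, reflectionMatrix_apply_succAbove_zero,
    reflectionMatrix_apply_succAbove_one, triple_apply_same, triple_apply_succAbove_zero,
    triple_apply_succAbove_one, Prod.fst_zero, Prod.snd_zero, zero_mul, mul_zero, one_mul, mul_one,
    zero_add, add_zero, star_one, star_add, star_sub, star_mul, star_star, star_smul, star_trivial,
    neg_smul, neg_mul, mul_neg, add_mul, mul_add, sub_mul, mul_sub, smul_mul_assoc, mul_smul_comm,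
    mul_star_self, star_mul_self, smul_smul, smul_zero, neg_zero, ← middle_moufang, hcancel,
    mul_mul_star, hnorm_zero, hnorm_one]
  refine ⟨⟨trivial, ?_, ?_⟩, ⟨?_, ?_, ?_⟩, ?_, ?_, ?_⟩
  · module
  · module
  · module
  · linear_combination (norm := module) r • hdiag_zero
  · module
  · module
  · module
  · linear_combination (norm := module) (-r) • hdiag_one

theorem reflectionIsometry_projector (h : r ^ 2 + ‖lam‖ ^ 2 = 1) (c : ℝ)
    (z : Octonion × Octonion) :
    reflectionIsometry i h (projector (triple i (c • 1) z)) =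
      projector (triple i (c • 1) (reflectionCoords r lam z)) := by
  rw [projector, projector, map_smul, sum_norm_sq_triple, sum_norm_sq_triple,
    sum_norm_sq_reflectionCoords h]
  exact congrArg _ (reflectionMatrix_mul_outer_mul i c z)

theorem reflectionIsometry_emb_ofCoords (h : r ^ 2 + ‖lam‖ ^ 2 = 1) (z : Octonion × Octonion) :
    reflectionIsometry i h (emb (ofCoords i z)) = emb (ofCoords i (reflectionCoords r lam z)) := by
  rw [emb_ofCoords, emb_ofCoords, ← one_smul ℝ (1 : Octonion), reflectionIsometry_projector]

theorem reflectionIsometry_emb_mem_range (h : r ^ 2 + ‖lam‖ ^ 2 = 1) (p : OP2) :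
    reflectionIsometry i h (emb p) ∈ Set.range emb := by
  have hclosed : IsClosed {p | reflectionIsometry i h (emb p) ∈ Set.range emb} := by
    rw [range_emb]
    exact isClosed_rankOneProjections.preimage
      ((reflectionIsometry i h).continuous.comp contMDiff_emb.continuous)
  refine (dense_range_ofCoords i).induction_on p hclosed fun z => ?_
  rw [reflectionIsometry_emb_ofCoords]
  exact Set.mem_range_self _

theorem exists_isGlobalReflection (h : r ^ 2 + ‖lam‖ ^ 2 = 1) :
    ∃ f, IsGlobalReflection i r lam f := by
  choose f hf using reflectionIsometry_emb_mem_range i h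
  refine ⟨f, contMDiff_of_contMDiff_emb_comp ?_, fun z => emb_injective ?_⟩
  · simp only [hf]
    exact (reflectionIsometry i h).toContinuousLinearMap.contMDiff.comp contMDiff_emb
  · rw [hf, reflectionIsometry_emb_ofCoords]

variable {i} {f : OP2 → OP2}

theorem IsGlobalReflection.continuous (hf : IsGlobalReflection i r lam f) : Continuous f :=
  hf.1.continuous

theorem IsGlobalReflection.unique {g : OP2 → OP2} (hf : IsGlobalReflection i r lam f)
    (hg : IsGlobalReflection i r lam g) : f = g :=
  (dense_range_ofCoords i).equalizer hf.continuous hg.continuous <| funext fun z =>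
    (hf.2 z).trans (hg.2 z).symm

theorem IsGlobalReflection.involutive (hf : IsGlobalReflection i r lam f)
    (h : r ^ 2 + ‖lam‖ ^ 2 = 1) : Function.Involutive f :=
  congrFun <| (dense_range_ofCoords i).equalizer (hf.continuous.comp hf.continuous) continuous_id <|
    funext fun z => by
      simp only [Function.comp_apply, hf.2, reflectionCoords_involutive h z]

theorem IsGlobalReflection.emb_apply (hf : IsGlobalReflection i r lam f)
    (h : r ^ 2 + ‖lam‖ ^ 2 = 1) (p : OP2) : emb (f p) = reflectionIsometry i h (emb p) :=
  congrFun ((dense_range_ofCoords i).equalizer (contMDiff_emb.continuous.comp hf.continuous)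
    ((reflectionIsometry i h).continuous.comp contMDiff_emb.continuous) <| funext fun z => by
      simp only [Function.comp_apply, hf.2, reflectionIsometry_emb_ofCoords]) p

theorem cos_sq_add_norm_sin_smul_one_sq (t : ℝ) :
    Real.cos t ^ 2 + ‖Real.sin t • (1 : Octonion)‖ ^ 2 = 1 := by
  rw [norm_smul, norm_one, mul_one, Real.norm_eq_abs, sq_abs, Real.cos_sq_add_sin_sq]

theorem one_sq_add_norm_zero_sq : (1 : ℝ) ^ 2 + ‖(0 : Octonion)‖ ^ 2 = 1 := by
  rw [norm_zero, one_pow, zero_pow two_ne_zero, add_zero]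

theorem zero_sq_add_norm_one_sq : (0 : ℝ) ^ 2 + ‖(1 : Octonion)‖ ^ 2 = 1 := by
  rw [norm_one, one_pow, zero_pow two_ne_zero, zero_add]

theorem existsUnique_isRotation (t : ℝ) : ∃! f, IsRotation t f := by
  obtain ⟨f₁, h₁⟩ := exists_isGlobalReflection 2 one_sq_add_norm_zero_sq
  obtain ⟨f₂, h₂⟩ := exists_isGlobalReflection 2 (cos_sq_add_norm_sin_smul_one_sq t)
  refine ⟨f₁ ∘ f₂, ⟨f₁, f₂, h₁, h₂, rfl⟩, ?_⟩
  rintro _ ⟨g₁, g₂, hg₁, hg₂, rfl⟩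
  rw [h₁.unique hg₁, h₂.unique hg₂]

end

/-! ### The metric -/

section InducedMetric

variable {E H M W : Type*} [NormedAddCommGroup E] [NormedSpace ℝ E] [TopologicalSpace H]
  {I : ModelWithCorners ℝ E H} [TopologicalSpace M] [ChartedSpace H M]
  [NormedAddCommGroup W] [InnerProductSpace ℝ W] {F : M → W}

variable (I) in
/-- The bilinear form which a map `F` to an inner product space induces on the tangent space at
`p`. -/
def inducedInner (F : M → W) (p : M) : TangentSpace I p →L[ℝ] TangentSpace I p →L[ℝ] ℝ :=
  ContinuousLinearMap.bilinearComp (E' := E) (F' := E) (innerSL ℝ) (mvfderiv I F p)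
    (mvfderiv I F p)

theorem inducedInner_apply (p : M) (w w' : TangentSpace I p) :
    inducedInner I F p w w' = inner ℝ (mvfderiv I F p w) (mvfderiv I F p w') := rfl

theorem inducedInner_self (p : M) (w : TangentSpace I p) :
    inducedInner I F p w w = ‖mvfderiv I F p w‖ ^ 2 :=
  real_inner_self_eq_norm_sq _

theorem inducedInner_comm (p : M) (w w' : TangentSpace I p) :
    inducedInner I F p w w' = inducedInner I F p w' w :=
  real_inner_comm _ _

theorem isVonNBounded_inducedInner [FiniteDimensional ℝ E] {p : M}
    (hinj : Function.Injective (mvfderiv I F p)) :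
    Bornology.IsVonNBounded ℝ {w : TangentSpace I p | inducedInner I F p w w < 1} := by
  let A : E →ₗ[ℝ] W := (mvfderiv I F p).toLinearMap
  obtain ⟨K, -, hK⟩ := A.exists_antilipschitzWith (LinearMap.ker_eq_bot.mpr hinj)
  refine (NormedSpace.isVonNBounded_closedBall ℝ E K).subset fun (w : E) hw => ?_
  have hAw : ‖A w‖ ^ 2 < 1 := (inducedInner_self p w).symm.trans_lt hw
  have hw_le : ‖w‖ ≤ K * ‖A w‖ := by
    simpa only [dist_zero_right, map_zero] using hK.le_mul_dist w 0
  refine mem_closedBall_zero_iff.mpr (hw_le.trans ?_)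
  exact mul_le_of_le_one_right K.2 ((sq_lt_one_iff₀ (norm_nonneg _)).mp hAw).le

theorem contMDiff_inducedInner [FiniteDimensional ℝ E] [IsManifold I 1 M] {n m : ℕ∞ω}
    (hF : ContMDiff I 𝓘(ℝ, W) n F) (hmn : m + 1 ≤ n) :
    ContMDiff I (I.prod 𝓘(ℝ, E →L[ℝ] E →L[ℝ] ℝ)) m fun p : M =>
      Bundle.TotalSpace.mk' (E →L[ℝ] E →L[ℝ] ℝ) (E := fun p : M =>
        TangentSpace I p →L[ℝ] TangentSpace I p →L[ℝ] Bundle.Trivial M ℝ p)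
        p (inducedInner I F p) := by
  intro p
  rw [contMDiffAt_hom_bundle]
  refine ⟨contMDiffAt_id, ?_⟩
  let dF : M → E →L[ℝ] W := inTangentCoordinates I 𝓘(ℝ, W) id F (mfderiv I 𝓘(ℝ, W) F) p
  have hdF : ContMDiffAt I 𝓘(ℝ, E →L[ℝ] W) m dF p := (hF p).mfderiv_const hmn
  have hdF_apply (q : M) (v : E) : dF q v = mvfderiv I F q
      ((trivializationAt E (TangentSpace I) p).symmL ℝ q v) := by
    change ((trivializationAt W (TangentSpace 𝓘(ℝ, W)) (F p)).continuousLinearMapAt ℝ (F q)) _ = _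
    rw [TangentBundle.continuousLinearMapAt_model_space]
    rfl
  have hcomp : ContDiff ℝ m fun A : E →L[ℝ] W => (innerSL ℝ).bilinearComp A A := by
    refine contDiff_clm_apply_iff.mpr fun v => contDiff_clm_apply_iff.mpr fun w => ?_
    exact (contDiff_id.clm_apply contDiff_const).inner ℝ
      (contDiff_id.clm_apply contDiff_const)
  refine (hcomp.contMDiff.contMDiffAt.comp p hdF).congr_of_eventuallyEq ?_
  filter_upwards [(trivializationAt E (TangentSpace I) p).open_baseSet.mem_nhds
    (FiberBundle.mem_baseSet_trivializationAt E (TangentSpace I) p)] with q hq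
  refine ContinuousLinearMap.ext fun v => ContinuousLinearMap.ext fun w => ?_
  refine (inCoordinates_apply_eq₂ hq hq (Set.mem_univ _)).trans ?_
  refine (DFunLike.congr_fun (Bundle.Trivial.linearMapAt_trivialization ℝ M ℝ q) _).trans ?_
  rw [← Bundle.Trivialization.symmL_apply (R := ℝ) _ hq,
    ← Bundle.Trivialization.symmL_apply (R := ℝ) _ hq]
  exact (congrArg₂ (inner ℝ) (hdF_apply q v) (hdF_apply q w)).symm

/-- The Riemannian metric induced by an immersion into an inner product space. -/
def inducedMetric [FiniteDimensional ℝ E] [IsManifold I 1 M] {n m : ℕ∞ω}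
    (hF : ContMDiff I 𝓘(ℝ, W) n F) (hmn : m + 1 ≤ n)
    (hinj : ∀ p, Function.Injective (mvfderiv I F p)) :
    Bundle.ContMDiffRiemannianMetric I m E fun p : M => TangentSpace I p where
  inner := inducedInner I F
  symm := inducedInner_comm
  pos p w hw := by
    rw [inducedInner_self]
    exact pow_pos (norm_pos_iff.mpr ((map_ne_zero_iff _ (hinj p)).mpr hw)) 2
  isVonNBounded p := isVonNBounded_inducedInner (hinj p)
  contMDiff := contMDiff_inducedInner hF hmn

theorem inducedInner_mfderiv_of_comp_eq (hF : MDifferentiable I 𝓘(ℝ, W) F) {f : M → M}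
    (hf : MDifferentiable I I f) (L : W →ₗᵢ[ℝ] W) (h : ∀ q, F (f q) = L (F q))
    (p : M) (w w' : TangentSpace I p) :
    inducedInner I F (f p) (mfderiv I I f p w) (mfderiv I I f p w') =
      inducedInner I F p w w' := by
  have hderiv (w : TangentSpace I p) :
      mvfderiv I F (f p) (mfderiv I I f p w) = L (mvfderiv I F p w) := by
    have hcomp := mfderiv_comp p (hF (f p)) (hf p)
    rw [show F ∘ f = L.toContinuousLinearMap ∘ F from funext h,
      mfderiv_comp p L.toContinuousLinearMap.mdifferentiableAt (hF p),
      L.toContinuousLinearMap.mfderiv_eq] at hcomp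
    exact (DFunLike.congr_fun hcomp w).symm
  rw [inducedInner_apply, inducedInner_apply, hderiv, hderiv, L.inner_map_map]

end InducedMetric

instance : IsManifold 𝓘𝕆² 1 OP2 := .of_le (n := ω) le_top

/-- The embedding, rescaled so that it induces exactly `ds²`. -/
def scaledEmb (p : OP2) : Matrix (Fin 3) (Fin 3) Octonion := (√2)⁻¹ • emb p

theorem contMDiff_scaledEmb :
    ContMDiff 𝓘𝕆² 𝓘(ℝ, Matrix (Fin 3) (Fin 3) Octonion) ω scaledEmb :=
  (contDiff_id.const_smul (√2)⁻¹).contMDiff.comp contMDiff_emb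

theorem mdifferentiable_scaledEmb :
    MDifferentiable 𝓘𝕆² 𝓘(ℝ, Matrix (Fin 3) (Fin 3) Octonion) scaledEmb :=
  contMDiff_scaledEmb.mdifferentiable (by simp)

theorem norm_sq_mvfderiv_scaledEmb {i : Fin 3} {p : OP2} (h : p ∈ (chart i).source)
    (w : TangentSpace 𝓘𝕆² p) :
    ‖mvfderiv 𝓘𝕆² scaledEmb p w‖ ^ 2 =
      ds2 (chart i p) (mfderiv 𝓘𝕆² 𝓘𝕆² (chart i) p w) := by
  let G (z : Octonion × Octonion) : Matrix (Fin 3) (Fin 3) Octonion := scaledEmb (ofCoords i z)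
  have hG : Differentiable ℝ G :=
    ((contDiff_emb_ofCoords i).const_smul (√2)⁻¹).differentiable (by simp)
  have hlocal : scaledEmb =ᶠ[nhds p] G ∘ chart i :=
    (emb_eventuallyEq h).mono fun q hq => congrArg ((√2)⁻¹ • ·) hq
  have hchain : mvfderiv 𝓘𝕆² scaledEmb p w =
      fderiv ℝ G (chart i p) (mfderiv 𝓘𝕆² 𝓘𝕆² (chart i) p w) := by
    have hcomp := mfderiv_comp p hG.mdifferentiable.mdifferentiableAt
      ((contMDiffAt_chart h).mdifferentiableAt (by simp))
    rw [← hlocal.mfderiv_eq, mfderiv_eq_fderiv] at hcomp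
    exact DFunLike.congr_fun hcomp w
  rw [hchain]
  let d : Octonion × Octonion := mfderiv 𝓘𝕆² 𝓘𝕆² (chart i) p w
  have hline : fderiv ℝ G (chart i p) d =
      (√2)⁻¹ • deriv (fun t : ℝ => projector (triple i 1 (chart i p + t • d))) 0 := by
    rw [← (hG _).lineDeriv_eq_fderiv, ← deriv_const_smul_field]
    rfl
  change ‖fderiv ℝ G (chart i p) d‖ ^ 2 = ds2 (chart i p) d
  rw [hline, norm_smul, mul_pow, norm_sq_deriv_projector_triple, norm_inv, inv_pow,
    Real.norm_eq_abs, sq_abs, Real.sq_sqrt zero_le_two, inv_mul_cancel_left₀ two_ne_zero]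

theorem injective_mvfderiv_scaledEmb (p : OP2) :
    Function.Injective (mvfderiv 𝓘𝕆² scaledEmb p) := by
  obtain ⟨i, hi⟩ := exists_mem_source p
  have hchart : ⇑(chart i) = (fun P => matrixCoords i (√2 • P)) ∘ scaledEmb :=
    funext fun q => by
      rw [Function.comp_apply, scaledEmb, smul_inv_smul₀ (Real.sqrt_ne_zero'.mpr two_pos),
        matrixCoords_emb]
      rfl
  have hG : MDifferentiableAt 𝓘(ℝ, Matrix (Fin 3) (Fin 3) Octonion) 𝓘𝕆²
      (fun P => matrixCoords i (√2 • P)) (scaledEmb p) := by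
    have hdiff : DifferentiableAt ℝ (matrixCoords i) (√2 • scaledEmb p) := by
      rw [scaledEmb, smul_inv_smul₀ (Real.sqrt_ne_zero'.mpr two_pos)]
      exact (contDiffAt_matrixCoords ((mem_source_iff i p).mp hi)).differentiableAt (by simp)
    exact (hdiff.comp (scaledEmb p) (differentiableAt_id.const_smul √2)).mdifferentiableAt
  have hcomp := mfderiv_comp p hG (mdifferentiable_scaledEmb p)
  have hinj : Function.Injective (mfderiv 𝓘𝕆² 𝓘𝕆² (chart i) p) :=
    (mdifferentiable_of_mem_atlas (show chart i ∈ atlas _ OP2 from ⟨i, rfl⟩)).mfderiv_injective hi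
  rw [hchart, hcomp] at hinj
  exact Function.Injective.of_comp hinj

/-- The metric `g` of `𝕆P²`. -/
def metric : SmoothMetric :=
  inducedMetric contMDiff_scaledEmb le_top injective_mvfderiv_scaledEmb

theorem isOctonionicMetric_metric : IsOctonionicMetric metric := fun _ _ hp w =>
  (inducedInner_self _ w).trans (norm_sq_mvfderiv_scaledEmb hp w)

theorem apply_eq_of_symm_of_apply_self_eq {V : Type*} [AddCommGroup V] [Module ℝ V]
    [TopologicalSpace V] {B B' : V →L[ℝ] V →L[ℝ] ℝ} (hB : ∀ v w, B v w = B w v)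
    (hB' : ∀ v w, B' v w = B' w v) (h : ∀ v, B v v = B' v v) : B = B' := by
  ext v w
  have hadd := h (v + w)
  simp only [map_add, add_apply, h v, h w, hB w v, hB' w v] at hadd
  linarith

theorem IsOctonionicMetric.eq_metric {g : SmoothMetric} (hg : IsOctonionicMetric g) :
    g = metric := by
  have h : g.inner = metric.inner := funext fun p => by
    obtain ⟨i, hi⟩ := exists_mem_source p
    exact apply_eq_of_symm_of_apply_self_eq (g.symm p) (metric.symm p) fun w =>
      (hg i p hi w).trans (isOctonionicMetric_metric i p hi w).symm
  cases g
  cases h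
  rfl

/-! ### Isometries -/

namespace IsRiemannianIsometry

variable {g : SmoothMetric} {f f' : OP2 → OP2}

theorem id (g : SmoothMetric) : IsRiemannianIsometry g id := by
  refine ⟨Diffeomorph.refl _ _ _, rfl, fun p w w' => ?_⟩
  rw [Diffeomorph.coe_refl, mfderiv_id]
  rfl

theorem comp (hf : IsRiemannianIsometry g f) (hf' : IsRiemannianIsometry g f') :
    IsRiemannianIsometry g (f ∘ f') := by
  obtain ⟨Φ, rfl, hΦ⟩ := hf
  obtain ⟨Ψ, rfl, hΨ⟩ := hf'
  refine ⟨Ψ.trans Φ, rfl, fun p w w' => ?_⟩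
  rw [Diffeomorph.coe_trans,
    mfderiv_comp p (Φ.mdifferentiable (by simp) _) (Ψ.mdifferentiable (by simp) _)]
  exact (hΦ _ _ _).trans (hΨ _ _ _)

theorem exists_leftInverse (hf : IsRiemannianIsometry g f) :
    ∃ f', IsRiemannianIsometry g f' ∧ Function.LeftInverse f' f := by
  obtain ⟨Φ, rfl, hΦ⟩ := hf
  refine ⟨Φ.symm, ⟨Φ.symm, rfl, fun p w w' => ?_⟩, Φ.symm_apply_apply⟩
  have hcomp : (mfderiv 𝓘𝕆² 𝓘𝕆² Φ (Φ.symm p)).comp (mfderiv 𝓘𝕆² 𝓘𝕆² Φ.symm p) =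
      ContinuousLinearMap.id ℝ (TangentSpace 𝓘𝕆² p) := by
    rw [← mfderiv_comp p (Φ.mdifferentiable (by simp) _) (Φ.symm.mdifferentiable (by simp) _),
      show Φ ∘ Φ.symm = _root_.id from funext Φ.apply_symm_apply]
    exact mfderiv_id
  have hderiv (w : TangentSpace 𝓘𝕆² p) :
      mfderiv 𝓘𝕆² 𝓘𝕆² Φ (Φ.symm p) (mfderiv 𝓘𝕆² 𝓘𝕆² Φ.symm p w) = w :=
    DFunLike.congr_fun hcomp w
  have hinner {q : OP2} (hq : q = p) (a b : Octonion × Octonion) :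
      g.inner q a b = g.inner p a b := by
    subst hq
    rfl
  refine (hΦ _ _ _).symm.trans (.trans ?_ (hinner (Φ.apply_symm_apply p) w w'))
  exact congrArg₂ (fun a b => g.inner (Φ (Φ.symm p)) a b) (hderiv w) (hderiv w')

end IsRiemannianIsometry

section

variable {g : SmoothMetric} {f : OP2 → OP2}

theorem IsGlobalReflection.isRiemannianIsometry {i : Fin 3} {r : ℝ} {lam : Octonion}
    (hf : IsGlobalReflection i r lam f) (h : r ^ 2 + ‖lam‖ ^ 2 = 1) (hg : IsOctonionicMetric g) :
    IsRiemannianIsometry g f := by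
  obtain rfl := hg.eq_metric
  have hsmooth : ContMDiff 𝓘𝕆² 𝓘𝕆² ∞ f := hf.1.of_le le_top
  have hcomp (q : OP2) : scaledEmb (f q) = reflectionIsometry i h (scaledEmb q) := by
    rw [scaledEmb, scaledEmb, hf.emb_apply h, map_smul]
  exact ⟨⟨(hf.involutive h).toPerm f, hsmooth, hsmooth⟩, rfl,
    inducedInner_mfderiv_of_comp_eq mdifferentiable_scaledEmb (hf.1.mdifferentiable (by simp)) _
      hcomp⟩

theorem IsRotation.isRiemannianIsometry {t : ℝ} (hf : IsRotation t f)
    (hg : IsOctonionicMetric g) : IsRiemannianIsometry g f := by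
  obtain ⟨f₁, f₂, h₁, h₂, rfl⟩ := hf
  exact (h₁.isRiemannianIsometry one_sq_add_norm_zero_sq hg).comp
    (h₂.isRiemannianIsometry (cos_sq_add_norm_sin_smul_one_sq t) hg)

theorem IsComposite.isRiemannianIsometry (hf : IsComposite f) (hg : IsOctonionicMetric g) :
    IsRiemannianIsometry g f := by
  induction hf with
  | refl => exact .id g
  | reflection_comp r lam ρ f h hρ _ ih => exact (hρ.isRiemannianIsometry h hg).comp ih
  | rotation_comp t ρ f hρ _ ih => exact (hρ.isRiemannianIsometry hg).comp ih

end

/-! ### Transitivity -/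

theorem reflectionIsometry_apply_succAbove_zero (i : Fin 3)
    (P : Matrix (Fin 3) (Fin 3) Octonion) :
    reflectionIsometry i zero_sq_add_norm_one_sq P (i.succAbove 0) (i.succAbove 0) =
      P (i.succAbove 1) (i.succAbove 1) := by
  change (reflectionMatrix i 0 1 * P * reflectionMatrix i 0 1) _ _ = _
  simp [Matrix.mul_apply, Fin.sum_univ_succAbove _ i, reflectionMatrix_apply_same,
    reflectionMatrix_apply_succAbove_zero, reflectionMatrix_apply_succAbove_one]

theorem reflectionIsometry_apply_succAbove_one (i : Fin 3)
    (P : Matrix (Fin 3) (Fin 3) Octonion) :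
    reflectionIsometry i one_sq_add_norm_zero_sq P (i.succAbove 1) (i.succAbove 1) =
      P (i.succAbove 1) (i.succAbove 1) := by
  change (reflectionMatrix i 1 0 * P * reflectionMatrix i 1 0) _ _ = _
  simp [Matrix.mul_apply, Fin.sum_univ_succAbove _ i, reflectionMatrix_apply_same,
    reflectionMatrix_apply_succAbove_zero, reflectionMatrix_apply_succAbove_one]

theorem IsGlobalReflection.mem_source_succAbove_zero_iff {i : Fin 3} {f : OP2 → OP2}
    (hf : IsGlobalReflection i 0 1 f) {p : OP2} :
    f p ∈ (chart (i.succAbove 0)).source ↔ p ∈ (chart (i.succAbove 1)).source := by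
  rw [mem_source_iff, mem_source_iff, hf.emb_apply zero_sq_add_norm_one_sq,
    reflectionIsometry_apply_succAbove_zero]

theorem IsGlobalReflection.mem_source_succAbove_one_iff {i : Fin 3} {f : OP2 → OP2}
    (hf : IsGlobalReflection i 1 0 f) {p : OP2} :
    f p ∈ (chart (i.succAbove 1)).source ↔ p ∈ (chart (i.succAbove 1)).source := by
  rw [mem_source_iff, mem_source_iff, hf.emb_apply one_sq_add_norm_zero_sq,
    reflectionIsometry_apply_succAbove_one]

theorem IsRotation.emb_apply_base {t : ℝ} {f : OP2 → OP2} (hf : IsRotation t f) :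
    emb (f (ofCoords 0 (0, 0))) =
      projector (triple 2 0 (Real.cos t • 1, -(Real.sin t • 1))) := by
  obtain ⟨f₁, f₂, h₁, h₂, rfl⟩ := hf
  have hbase : triple 0 1 (0, 0) = triple 2 ((0 : ℝ) • 1) (1, 0) := by
    rw [zero_smul]
    ext1 k
    fin_cases k <;> rfl
  rw [Function.comp_apply, h₁.emb_apply one_sq_add_norm_zero_sq,
    h₂.emb_apply (cos_sq_add_norm_sin_smul_one_sq t), emb_ofCoords, hbase,
    reflectionIsometry_projector, reflectionIsometry_projector, zero_smul]
  simp [reflectionCoords]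

/-- A point to which a finite composition of reflections of `U₁ / ∼` and rotations takes
`[1, 0, 0]`. -/
def Reachable (p : OP2) : Prop := ∃ f, IsComposite f ∧ f (ofCoords 0 (0, 0)) = p

theorem reachable_base : Reachable (ofCoords 0 (0, 0)) := ⟨id, .refl, rfl⟩

namespace Reachable

variable {p : OP2} {z : Octonion × Octonion} {r : ℝ} {lam : Octonion} {ρ : OP2 → OP2}

theorem reflection (hp : Reachable p) (h : r ^ 2 + ‖lam‖ ^ 2 = 1)
    (hρ : IsGlobalReflection 0 r lam ρ) : Reachable (ρ p) := by
  obtain ⟨f, hf, rfl⟩ := hp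
  exact ⟨ρ ∘ f, .reflection_comp r lam ρ f h hρ hf, rfl⟩

theorem rotation {t : ℝ} (hp : Reachable p) (hρ : IsRotation t ρ) : Reachable (ρ p) := by
  obtain ⟨f, hf, rfl⟩ := hp
  exact ⟨ρ ∘ f, .rotation_comp t ρ f hρ hf, rfl⟩

theorem reflectionCoords (hz : Reachable (ofCoords 0 z)) (h : r ^ 2 + ‖lam‖ ^ 2 = 1) :
    Reachable (ofCoords 0 (reflectionCoords r lam z)) := by
  obtain ⟨ρ, hρ⟩ := exists_isGlobalReflection 0 h
  rw [← hρ.2]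
  exact hz.reflection h hρ

end Reachable

theorem reachable_ofCoords_smul_one (x : ℝ) : Reachable (ofCoords 0 (x • 1, 0)) := by
  obtain ⟨ρ, hρ, -⟩ := existsUnique_isRotation (-Real.arctan x)
  have htriple : triple 2 0 (Real.cos (Real.arctan x) • 1, Real.sin (Real.arctan x) • 1) =
      Real.cos (Real.arctan x) • triple 0 1 (x • 1, 0) := by
    have hsin : Real.cos (Real.arctan x) * x = Real.sin (Real.arctan x) := by
      rw [mul_comm, Real.cos_arctan, Real.sin_arctan, mul_one_div]
    have hentry : Real.sin (Real.arctan x) • (1 : Octonion) =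
        Real.cos (Real.arctan x) • x • 1 := by
      rw [smul_smul, hsin]
    ext1 k
    fin_cases k
    exacts [rfl, hentry, (smul_zero (Real.cos (Real.arctan x))).symm]
  have h : ρ (ofCoords 0 (0, 0)) = ofCoords 0 (x • 1, 0) := by
    apply emb_injective
    rw [hρ.emb_apply_base, Real.cos_neg, Real.sin_neg, neg_smul, neg_neg, htriple,
      projector_smul (Real.cos_arctan_pos x).ne', emb_ofCoords]
  rw [← h]
  exact reachable_base.rotation hρ

theorem exists_norm_eq_one_and_norm_smul_eq {E : Type*} [NormedAddCommGroup E] [NormedSpace ℝ E]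
    [Nontrivial E] (b : E) : ∃ w : E, ‖w‖ = 1 ∧ ‖b‖ • w = b := by
  obtain rfl | hb := eq_or_ne b 0
  · obtain ⟨w, hw⟩ := exists_norm_eq E zero_le_one
    exact ⟨w, hw, by rw [norm_zero, zero_smul]⟩
  · exact ⟨‖b‖⁻¹ • b, norm_smul_inv_norm hb, smul_inv_smul₀ (norm_ne_zero_iff.mpr hb) b⟩

/-- The reflection with `r = 0`, `λ = w̄` takes `(x, 0)` to `(0, x w)`, where `b = |b| w`; a second
one turns this into `(a, b)`. -/
theorem reachable_ofCoords_zero (z : Octonion × Octonion) : Reachable (ofCoords 0 z) := by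
  obtain ⟨a, b⟩ := z
  have : Nontrivial Octonion := NormOneClass.nontrivial
  obtain ⟨w, hw, hb⟩ := exists_norm_eq_one_and_norm_smul_eq b
  let x := √(‖a‖ ^ 2 + ‖b‖ ^ 2)
  have hx_sq : x ^ 2 = ‖a‖ ^ 2 + ‖b‖ ^ 2 := Real.sq_sqrt (by positivity)
  obtain hx | hx := eq_or_ne x 0
  · have hab : ‖a‖ ^ 2 + ‖b‖ ^ 2 = 0 := by rw [← hx_sq, hx, zero_pow two_ne_zero]
    obtain ⟨rfl, rfl⟩ : a = 0 ∧ b = 0 := by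
      simpa using (add_eq_zero_iff_of_nonneg (sq_nonneg _) (sq_nonneg _)).mp hab
    exact reachable_base
  have h₁ : (0 : ℝ) ^ 2 + ‖star w‖ ^ 2 = 1 := by rw [norm_star, hw]; norm_num
  have h₂ : (-(‖b‖ / x)) ^ 2 + ‖x⁻¹ • (a * star w)‖ ^ 2 = 1 := by
    rw [norm_smul, norm_mul, norm_star, hw, mul_one, mul_pow, norm_inv, Real.norm_eq_abs,
      inv_pow, sq_abs]
    field_simp
    linarith
  have hz : reflectionCoords (-(‖b‖ / x)) (x⁻¹ • (a * star w))
      (reflectionCoords 0 (star w) (x • 1, 0)) = (a, b) := by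
    simp [reflectionCoords, smul_smul, mul_star_mul, hw, hx, hb, smul_mul_assoc, mul_smul_comm]
  rw [← hz]
  exact ((reachable_ofCoords_smul_one x).reflectionCoords h₁).reflectionCoords h₂

theorem reachable_of_mem_source_zero {p : OP2} (hp : p ∈ (chart 0).source) : Reachable p := by
  rw [← ofCoords_coords hp]
  exact reachable_ofCoords_zero _

theorem reachable_of_mem_source_one {p : OP2} (hp : p ∈ (chart 1).source) : Reachable p := by
  obtain ⟨ρ, hρ, -⟩ := existsUnique_isRotation (Real.pi / 2)
  obtain ⟨f₁, f₂, h₁, h₂, rfl⟩ := id hρ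
  have hinv : f₁ (f₂ (f₂ (f₁ p))) = p := by
    rw [h₂.involutive (cos_sq_add_norm_sin_smul_one_sq _), h₁.involutive one_sq_add_norm_zero_sq]
  rw [Real.cos_pi_div_two, Real.sin_pi_div_two, one_smul] at h₂
  have hq : f₂ (f₁ p) ∈ (chart 0).source :=
    h₂.mem_source_succAbove_zero_iff.mpr (h₁.mem_source_succAbove_one_iff.mpr hp)
  rw [← hinv]
  exact (reachable_of_mem_source_zero hq).rotation hρ

theorem reachable_of_mem_source_two {p : OP2} (hp : p ∈ (chart 2).source) : Reachable p := by
  obtain ⟨ρ, hρ⟩ := exists_isGlobalReflection 0 zero_sq_add_norm_one_sq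
  have hq : ρ p ∈ (chart 1).source := hρ.mem_source_succAbove_zero_iff.mpr hp
  rw [← hρ.involutive zero_sq_add_norm_one_sq p]
  exact (reachable_of_mem_source_one hq).reflection zero_sq_add_norm_one_sq hρ

theorem reachable (p : OP2) : Reachable p := by
  obtain ⟨i, hi⟩ := exists_mem_source p
  fin_cases i
  · exact reachable_of_mem_source_zero hi
  · exact reachable_of_mem_source_one hi
  · exact reachable_of_mem_source_two hi

theorem IsOctonionicMetric.isHomogeneous {g : SmoothMetric} (hg : IsOctonionicMetric g) :
    IsHomogeneous g := by
  intro p q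
  obtain ⟨f, hf, rfl⟩ := reachable p
  obtain ⟨f', hf', rfl⟩ := reachable q
  obtain ⟨k, hk, hkf⟩ := (hf.isRiemannianIsometry hg).exists_leftInverse
  exact ⟨f' ∘ k, (hf'.isRiemannianIsometry hg).comp hk, congrArg f' (hkf _)⟩

end OP2

end

theorem mainTheorem1 :
    (∃! g : OP2.SmoothMetric, OP2.IsOctonionicMetric g) ∧
    (∀ (i : Fin 3) (r : ℝ) (lam : Octonion), r ^ 2 + ‖lam‖ ^ 2 = 1 →
      ∃! f : OP2 → OP2, OP2.IsGlobalReflection i r lam f) ∧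
    (∀ t : ℝ, ∃! f : OP2 → OP2, OP2.IsRotation t f) ∧
    ∀ g : OP2.SmoothMetric, OP2.IsOctonionicMetric g →
      OP2.IsHomogeneous g ∧
      (∀ (i : Fin 3) (r : ℝ) (lam : Octonion) (f : OP2 → OP2), r ^ 2 + ‖lam‖ ^ 2 = 1 →
        OP2.IsGlobalReflection i r lam f →
          OP2.IsRiemannianIsometry g f ∧ Function.Involutive f) ∧
      (∀ f : OP2 → OP2, OP2.IsComposite f → OP2.IsRiemannianIsometry g f) ∧
      (∀ p : OP2, ∃ f : OP2 → OP2, OP2.IsComposite f ∧ f (OP2.ofCoords 0 (0, 0)) = p) := by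
  refine ⟨⟨OP2.metric, OP2.isOctonionicMetric_metric, fun g hg => hg.eq_metric⟩,
    fun i r lam h => ?_, OP2.existsUnique_isRotation, fun g hg => ⟨hg.isHomogeneous,
    fun i r lam f h hf => ⟨hf.isRiemannianIsometry h hg, hf.involutive h⟩,
    fun f hf => hf.isRiemannianIsometry hg, OP2.reachable⟩⟩
  obtain ⟨f, hf⟩ := OP2.exists_isGlobalReflection i h
  exact ⟨f, hf, fun f' hf' => hf'.unique hf⟩
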